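/- Let $d\ge 2$, $L\ge R>0$ and $\mathcal D_L=[-L,L]^d$. Let $\Phi\ge 0$ be measurable with $\mathbf 1_{|v|\le R}\Phi(|v|)\in L^\infty(\mathcal D_L)$. Let $b$ be the symmetrized angular kernel $b(\cos\theta)=[b_0(\cos\theta)+b_0(\cos(\pi-\theta))]\,\mathbf 1_{0\le\theta\le\pi/2}$ of a measurable function $b_0\ge 0$ on $[-1,1]$, and assume the cut-off condition $\int_{\mathbb S^{d-1}}b(\sigma\cdot e)\,d\sigma<\infty$ for unit vectors $e$. Put $B=\Phi\,b$ and $$Q^R(g,f)(v)=\int_{|q|\le R}\int_{\mathbb S^{d-1}}\Phi(|q|)\,b(\sigma\cdot\hat q)\,\big[g(v_*')f(v')-g(v-q)f(v)\big]\,d\sigma\,dq,$$ where $\hat q=q/|q|$, $v'=v-\tfrac{q-|q|\sigma}{2}$ and $v_*'=v-\tfrac{q+|q|\sigma}{2}$. For an integer $N\ge 1$ let $\mathbb P_N=\mathrm{span}\{e^{i\frac{\pi}{L}k\cdot v}: k\in\mathbb Z^d,\ -N/2\le k_j\le N/2 \text{ for } j=1,\dots,d\}$, and let $\mathcal P_N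 g=\sum_{k}\hat g_k e^{i\frac{\pi}{L}k\cdot v}$ (sum over the same $k$), with $\hat g_k=(2L)^{-d}\int_{\mathcal D_L}g\,e^{-i\frac{\pi}{L}k\cdot v}\,dv$, be the projection onto $\mathbb P_N$. Write $f^-=\max(-f,0)$, and set $\|f\|_{H^1}^2=\|f\|_{L^2}^2+\sum_{i=1}^d\|\partial_{v_i}f\|_{L^2}^2$; all norms are over $\mathcal D_L$. Then there are positive constants $D_0,D_1,D_2,D_3,D_4$, depending only on $R$, $L$, $d$ and $B$, such that the following holds. Let $N\ge 1$, $t_0\ge 0$ and $M>0$, and let $f_N$ be a real-valued solution on $[0,t_0]$, with $f_N(t,\cdot)\in\mathbb P_N$, of $$\partial_t f_N=\mathcal P_N Q^R(f_N,f_N)\quad(0<t\le t_0),\qquad f_N(0,\cdot)=f_N^0\in\mathbb P_N$$ (so that in particular $f_N^0\in H^1(\mathcal D_L)$). Assume that $\|f_N(t)\|_{L^1}\le M$ for all $t\in[0,t_0]$. Put $$K_0=e^{t_0D_0M}\|f_N^0\|_{L^2},\qquad K_1=e^{t_0D_1(M+K_0)}\big(\|f_N^0\|_{H^1}+D_2\big).$$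 Then for all $t\in[0,t_0]$, $$\|f_N(t)\|_{L^2}\le K_0,\qquad \|f_N(t)\|_{H^1}\le K_1,\qquad \|f_N^-(t)\|_{L^2}\le e^{t_0D_3(M+K_0)}\Big(\|f_N^{0,-}\|_{L^2}+\frac{D_4K_1^2}{MN}\Big).$$ -/

import Mathlib

open MeasureTheory Metric Set
open scoped RealInnerProductSpace ComplexConjugate

noncomputable section

namespace FourierBoltzmann

variable {d : ℕ}

/-- The velocity space `ℝ^d` with its Euclidean norm. -/
abbrev Vel (d : ℕ) : Type := EuclideanSpace ℝ (Fin d)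

/-- The torus cell `[-L, L]^d`. -/
def cell (d : ℕ) (L : ℝ) : Set (Vel d) := {v | ∀ i, v i ∈ Icc (-L) L}

/-- Lebesgue measure on the cell `[-L, L]^d`. -/
def cellMeasure (d : ℕ) (L : ℝ) : Measure (Vel d) := volume.restrict (cell d L)

/-- The `L^1` norm over the cell. -/
def normL1 (L : ℝ) (f : Vel d → ℝ) : ℝ := lpNorm f 1 (cellMeasure d L)

/-- The `L^2` norm over the cell. -/
def normL2 (L : ℝ) (f : Vel d → ℝ) : ℝ := lpNorm f 2 (cellMeasure d L)

/-- The partial derivative in the `i`-th coordinate direction. -/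
def partialDeriv (i : Fin d) (f : Vel d → ℝ) (v : Vel d) : ℝ :=
  fderiv ℝ f v (EuclideanSpace.single i 1)

/-- The `H^1` norm over the cell, the square root of `∑_{|ν| ≤ 1} ‖∂^ν f‖²` in `L^2`. It is only
applied to trigonometric polynomials, whose weak derivatives are the classical ones. -/
def normH1 (L : ℝ) (f : Vel d → ℝ) : ℝ :=
  Real.sqrt (normL2 L f ^ 2 + ∑ i, normL2 L (partialDeriv i f) ^ 2)

/-- The negative part `f⁻ = max (-f, 0)`, so that `f = f⁺ - f⁻`. -/
def negativePart (f : Vel d → ℝ) (v : Vel d) : ℝ := max (-f v) 0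

/-- The Fourier mode `exp (i (π / L) k · v)`. -/
def fourierMode (L : ℝ) (k : Fin d → ℤ) (v : Vel d) : ℂ :=
  Complex.exp (Complex.I * ((Real.pi / L * ∑ j, (k j : ℝ) * v j : ℝ) : ℂ))

/-- The indices `k ∈ ℤ^d` with `-N/2 ≤ k_j ≤ N/2` for all `j`. The division is that of `ℤ`, which
rounds down and does not change the set of integers described by the two inequalities. -/
def modes (d N : ℕ) : Finset (Fin d → ℤ) :=
  Fintype.piFinset fun _ => Finset.Icc (-((N : ℤ) / 2)) ((N : ℤ) / 2)

/-- The space `ℙ_N` spanned by the Fourier modes of index in `modes d N`. -/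
def trigSpace (d : ℕ) (L : ℝ) (N : ℕ) : Submodule ℂ (Vel d → ℂ) :=
  Submodule.span ℂ (fourierMode L '' (modes d N : Set (Fin d → ℤ)))

/-- A real-valued function that belongs to `ℙ_N`. -/
def IsRealTrig (L : ℝ) (N : ℕ) (f : Vel d → ℝ) : Prop :=
  (fun v => (f v : ℂ)) ∈ trigSpace d L N

/-- The Fourier coefficient `(2L)^{-d} ∫ g conj(exp (i (π / L) k · v)) dv` over the cell. -/
def fourierCoefficient (L : ℝ) (g : Vel d → ℝ) (k : Fin d → ℤ) : ℂ :=
  (1 / ((2 * L : ℝ) : ℂ) ^ d) * ∫ v, (g v : ℂ) * conj (fourierMode L k v) ∂(cellMeasure d L)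

/-- The projection onto `ℙ_N`. -/
def fourierProj (L : ℝ) (N : ℕ) (g : Vel d → ℝ) (v : Vel d) : ℂ :=
  ∑ k ∈ modes d N, fourierCoefficient L g k * fourierMode L k v

/-- The symmetrized angular kernel `[b (cos θ) + b (cos (π - θ))] 1_{0 ≤ θ ≤ π/2}`, as a function
of `c = cos θ`. -/
def symmetrized (b : ℝ → ℝ) (c : ℝ) : ℝ := if 0 ≤ c then b c + b (-c) else 0

/-- Surface measure on the unit sphere of `ℝ^d`. -/
def sphereMeasure (d : ℕ) : Measure (sphere (0 : Vel d) 1) := (volume : Measure (Vel d)).toSphere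

/-- The truncated collision operator
`Q^R(g, f)(v) = ∫_{|q| ≤ R} ∫_{S^{d-1}} Φ(|q|) b(σ · q̂) [g(v'_*) f(v') - g(v - q) f(v)] dσ dq`
with `v' = v - (q - |q| σ) / 2`, `v'_* = v - (q + |q| σ) / 2` and `q̂ = q / |q|`. -/
def collision (Φ b : ℝ → ℝ) (R : ℝ) (g f : Vel d → ℝ) (v : Vel d) : ℝ :=
  ∫ q in closedBall (0 : Vel d) R, ∫ σ : sphere (0 : Vel d) 1,
    Φ ‖q‖ * b ⟪(σ : Vel d), ‖q‖⁻¹ • q⟫ *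
      (g (v - (1 / 2 : ℝ) • (q + ‖q‖ • (σ : Vel d))) * f (v - (1 / 2 : ℝ) • (q - ‖q‖ • (σ : Vel d)))
        - g (v - q) * f v) ∂(sphereMeasure d)

/-- `f` is a real-valued solution on `[0, t₀]`, with initial value `f₀`, of the Fourier-Galerkin
system `∂_t f = P_N Q^R(f, f)` in `ℙ_N`: it takes values in `ℙ_N`, is continuous on `[0, t₀]`, and
satisfies the equation at positive times (with the left derivative at `t₀`). -/
structure IsGalerkinSolution (Φ b : ℝ → ℝ) (R L : ℝ) (N : ℕ) (t₀ : ℝ) (f₀ : Vel d → ℝ)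
    (f : ℝ → Vel d → ℝ) : Prop where
  mem : ∀ t ∈ Icc 0 t₀, IsRealTrig L N (f t)
  init : f 0 = f₀
  cont : ∀ v, ContinuousOn (fun t => f t v) (Icc 0 t₀)
  eqn : ∀ t ∈ Ioc 0 t₀, ∀ v, HasDerivWithinAt (fun s => (f s v : ℂ))
    (fourierProj L N (collision Φ b R (f t) (f t)) v) (Icc 0 t₀) t

/-- The bound `K₀ = exp (t₀ D₀ M) ‖f₀‖` with the `L^2` norm. -/
def boundK0 (L D₀ t₀ M : ℝ) (f₀ : Vel d → ℝ) : ℝ := Real.exp (t₀ * D₀ * M) * normL2 L f₀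

/-- The bound `K₁ = exp (t₀ D₁ (M + K₀)) (‖f₀‖ + D₂)` with the `H^1` norm. -/
def boundK1 (L D₀ D₁ D₂ t₀ M : ℝ) (f₀ : Vel d → ℝ) : ℝ :=
  Real.exp (t₀ * D₁ * (M + boundK0 L D₀ t₀ M f₀)) * (normH1 L f₀ + D₂)

end FourierBoltzmann

end

/-!
The theorem rests on a single bilinear estimate, `‖Q(g, f)‖_{L²} ≤ C ‖g‖_{L¹} ‖f‖_{L²}` over the
cell, for periodic `g` and `f` (`BoundedLaws.normL2_collide_le`).

*The estimate.* Let `κ` be the measure `Φ(|q|) b(σ · q̂) dq dσ` on `{|q| ≤ R} × S^{d-1}`. The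
displacements `v - v'_* = (q + |q| σ) / 2`, `v' - v'_* = |q| σ` and `v - v_* = q` are equivariant
under rotations of the pair `(q, σ)`, and on the support of the symmetrized kernel (`θ ≤ π / 2`)
their lengths lie between `|q| / 2` and `|q|`. Averaging a test function over the orthogonal group
with its Haar measure leaves only the lengths of the displacements, so that a dilation in `q` shows
that their laws under `κ` have bounded densities (`lintegral_equivariant_le`,
`exists_boundedLaws`). No Jacobian of the collision map is needed. The Cauchy–Schwarz inequality
with weight `g(v'_*)`, followed by a translation of `v` over the period cell, turns this into the
bilinear estimate.

*Propagation.* The projection onto `ℙ_N` is a contraction of `L²`, so `‖f‖_{L²}` grows at a rate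
proportional to `M`. The collision of two trigonometric polynomials is again one, and
`∂_i Q(f, f) = Q(∂_i f, f) + Q(f, ∂_i f)` (`diffCoef_collideCoef`); since the `L¹` and `L²` norms of
`f` are under control, `‖∂_i f‖_{L²}` grows at a rate proportional to `M + K₀`.

*Negativity.* In `-∫ f⁻ Q(f, f)` the negative contributions of the gain term carry a further factor
`f⁻`, and so does the loss term
(`BoundedLaws.neg_integral_negativePart_mul_collide_le`). Hence `‖f⁻‖_{L²}` is amplified at a rate
proportional to `M + K₀`, and its only source is `Q(f, f) - 𝒫_N Q(f, f)`, which is of order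
`‖f‖_{H¹}² / N`, because the discarded frequencies exceed `N / 2`
(`BoundedLaws.normL2_collide_sub_le`).

The differential inequalities are legitimate because the Fourier coefficients of a pointwise
solution are differentiable (`exists_isCoefFlow`): they are combinations of finitely many point
values.
-/

namespace FourierBoltzmann

open scoped ENNReal NNReal Topology

noncomputable section

/-! ### Rotation invariance and rotational means -/

/-- The map of the unit sphere induced by a linear isometry. -/
def sphereMap {d : ℕ} (U : Vel d ≃ₗᵢ[ℝ] Vel d) (σ : sphere (0 : Vel d) 1) :
    sphere (0 : Vel d) 1 :=
  ⟨U σ, by simp⟩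

lemma continuous_sphereMap {d : ℕ} (U : Vel d ≃ₗᵢ[ℝ] Vel d) : Continuous (sphereMap U) :=
  Continuous.subtype_mk (U.continuous.comp continuous_subtype_val) _

open scoped Pointwise in
lemma measurePreserving_sphereMap {d : ℕ} (U : Vel d ≃ₗᵢ[ℝ] Vel d) :
    MeasurePreserving (sphereMap U) (sphereMeasure d) (sphereMeasure d) := by
  refine ⟨(continuous_sphereMap U).measurable, ?_⟩
  ext s hs
  have hm := (continuous_sphereMap U).measurable
  rw [Measure.map_apply hm hs, sphereMeasure, Measure.toSphere_apply' _ hs,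
    Measure.toSphere_apply' _ (hm hs)]
  congr 1
  have h : Ioo (0 : ℝ) 1 • ((↑) '' (sphereMap U ⁻¹' s) : Set (Vel d)) =
      U ⁻¹' (Ioo (0 : ℝ) 1 • ((↑) '' s : Set (Vel d))) := by
    ext x
    simp only [Set.mem_smul, Set.mem_preimage, Set.mem_image]
    constructor
    · rintro ⟨r, hr, _, ⟨σ, hσ, rfl⟩, rfl⟩
      exact ⟨r, hr, _, ⟨_, hσ, rfl⟩, by simp [sphereMap]⟩
    · rintro ⟨r, hr, _, ⟨σ, hσ, rfl⟩, hx⟩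
      refine ⟨r, hr, _, ⟨sphereMap U.symm σ, ?_, rfl⟩, ?_⟩
      · have : sphereMap U (sphereMap U.symm σ) = σ := by
          ext1; simp [sphereMap]
        rwa [this]
      · apply U.injective
        simp [← hx, sphereMap]
  rw [h]
  exact U.measurePreserving.measure_preimage_equiv (f := U.toMeasurableEquiv) _

instance instFiniteSphereMeasure (d : ℕ) : IsFiniteMeasure (sphereMeasure d) := by
  unfold sphereMeasure; infer_instance

/-- Linear isometries act transitively on each sphere. -/
lemma exists_isometry_of_norm_eq {d : ℕ} {x y : Vel d} (h : ‖x‖ = ‖y‖) :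
    ∃ U : Vel d ≃ₗᵢ[ℝ] Vel d, U x = y :=
  ⟨_, Submodule.reflection_sub h⟩

/-- By rotation invariance, the integral over the sphere of a function of `σ · e` depends on `e`
through its norm only. -/
lemma lintegral_sphere_inner {d : ℕ} {F : ℝ → ℝ≥0∞} {e e' : Vel d}
    (h : ‖e‖ = ‖e'‖) :
    ∫⁻ σ, F ⟪(σ : Vel d), e⟫ ∂sphereMeasure d = ∫⁻ σ, F ⟪(σ : Vel d), e'⟫ ∂sphereMeasure d := by
  obtain ⟨U, rfl⟩ := exists_isometry_of_norm_eq h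
  have hU : MeasurableEmbedding (sphereMap U) := by
    refine Topology.IsClosedEmbedding.measurableEmbedding ?_
    refine (continuous_sphereMap U).isClosedEmbedding ?_
    intro a b hab
    ext1
    exact U.injective (congrArg Subtype.val hab)
  rw [← (measurePreserving_sphereMap U).lintegral_comp_emb hU (fun σ => F ⟪(σ : Vel d), U e⟫)]
  simp [sphereMap]

section Rotations

variable {E : Type*} [NormedAddCommGroup E] [InnerProductSpace ℝ E] [FiniteDimensional ℝ E]
  [CompleteSpace E]

/-- The orthogonal group of `E`, as a subgroup of the bounded operators. -/
abbrev Rot (E : Type*) [NormedAddCommGroup E] [InnerProductSpace ℝ E] [CompleteSpace E] :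
    Type _ :=
  unitary (E →L[ℝ] E)

instance instMeasurableSpaceRot : MeasurableSpace (Rot E) := borel _

instance instBorelSpaceRot : BorelSpace (Rot E) := ⟨rfl⟩

instance instCompactSpaceRot : CompactSpace (Rot E) := by
  have : ProperSpace (E →L[ℝ] E) := FiniteDimensional.proper ℝ _
  refine isCompact_iff_compactSpace.mp (Metric.isCompact_of_isClosed_isBounded ?_ ?_)
  · exact isClosed_unitary
  · refine isBounded_iff_forall_norm_le.2 ⟨1, fun A hA => ?_⟩
    exact ContinuousLinearMap.opNorm_le_bound _ zero_le_one fun x => by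
      have h := (Unitary.linearIsometryEquiv (⟨A, hA⟩ : Rot E)).norm_map x
      rw [one_mul]
      exact h.le

/-- The Haar probability measure on the orthogonal group. -/
def rotMeasure : Measure (Rot E) := Measure.haarMeasure ⊤

instance instProbabilityRot : IsProbabilityMeasure (rotMeasure : Measure (Rot E)) :=
  ⟨Measure.haarMeasure_self⟩

instance instLeftInvariantRot : (rotMeasure : Measure (Rot E)).IsMulLeftInvariant := by
  unfold rotMeasure; infer_instance

/-- The isometry given by the inverse of `A`. The inverse turns the left invariance of the Haar
measure into invariance of the means `rotMean`. -/
def rotInv (A : Rot E) : E ≃ₗᵢ[ℝ] E := Unitary.linearIsometryEquiv A⁻¹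

/-- The mean of `G` over the orbit of `x` under the orthogonal group. -/
def rotMean (G : E → ℝ≥0∞) (x : E) : ℝ≥0∞ :=
  ∫⁻ A : Rot E, G (rotInv A x) ∂rotMeasure

/-- Rotational means are radial: the orthogonal group is transitive on spheres, and a change of
base point is absorbed by the invariance of the Haar measure. -/
lemma rotMean_eq_of_norm_eq {G : E → ℝ≥0∞} {x y : E}
    (h : ‖x‖ = ‖y‖) : rotMean G x = rotMean G y := by
  obtain ⟨U, rfl⟩ : ∃ U : E ≃ₗᵢ[ℝ] E, U x = y := ⟨_, Submodule.reflection_sub h⟩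
  set B : Rot E := Unitary.linearIsometryEquiv.symm U with hBdef
  have hB : Unitary.linearIsometryEquiv B = U := by simp [B]
  rw [rotMean, ← lintegral_mul_left_eq_self (μ := rotMeasure) _ B⁻¹, rotMean]
  refine lintegral_congr fun A => ?_
  have h : (B⁻¹ * A)⁻¹ = A⁻¹ * B := by group
  rw [rotInv, h, map_mul, hB]
  rfl

variable [MeasurableSpace E] [BorelSpace E]

lemma measurable_rotInv_apply : Measurable fun p : Rot E × E => rotInv p.1 p.2 := by
  apply Continuous.measurable
  have h1 : Continuous fun p : Rot E × E => ((p.1⁻¹ : Rot E) : E →L[ℝ] E) :=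
    continuous_subtype_val.comp (continuous_inv.comp continuous_fst)
  exact h1.clm_apply continuous_snd

lemma measurable_rotMean {G : E → ℝ≥0∞} (hG : Measurable G) : Measurable (rotMean G) :=
  (hG.comp measurable_rotInv_apply).lintegral_prod_left'

/-- Averaging over rotations does not change the integral over a centred ball. -/
lemma setLIntegral_rotMean (μ : Measure E) (hμ : ∀ U : E ≃ₗᵢ[ℝ] E, MeasurePreserving U μ μ)
    [SFinite μ] {G : E → ℝ≥0∞} (hG : Measurable G) (R : ℝ) :
    ∫⁻ x in closedBall 0 R, rotMean G x ∂μ = ∫⁻ x in closedBall 0 R, G x ∂μ := by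
  have h : ∀ U : E ≃ₗᵢ[ℝ] E, ∫⁻ x in closedBall 0 R, G (U x) ∂μ =
      ∫⁻ x in closedBall 0 R, G x ∂μ := by
    intro U
    have hpre : U ⁻¹' closedBall 0 R = closedBall 0 R := by
      ext x; simp
    have := (hμ U).setLIntegral_comp_preimage (s := closedBall 0 R) measurableSet_closedBall hG
    rwa [hpre] at this
  unfold rotMean
  rw [lintegral_lintegral_swap]
  · simp [h]
  · exact ((hG.comp measurable_rotInv_apply).comp measurable_swap).aemeasurable

/-- If the law of `W` under the weight `w` is rotation invariant, an integrand may be replaced by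
its rotational mean. -/
lemma lintegral_mul_rotMean {P : Type*} [MeasurableSpace P] {μ : Measure P} [SFinite μ]
    {w : P → ℝ≥0∞} (hw : Measurable w) {W : P → E} (hW : Measurable W) {G : E → ℝ≥0∞}
    (hG : Measurable G)
    (hinv : ∀ U : E ≃ₗᵢ[ℝ] E, ∫⁻ p, w p * G (U (W p)) ∂μ = ∫⁻ p, w p * G (W p) ∂μ) :
    ∫⁻ p, w p * rotMean G (W p) ∂μ = ∫⁻ p, w p * G (W p) ∂μ := by
  have hm : Measurable fun p : P × Rot E => w p.1 * G (rotInv p.2 (W p.1)) :=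
    (hw.comp measurable_fst).mul (hG.comp (measurable_rotInv_apply.comp
      (f := fun p : P × Rot E => (p.2, W p.1)) (measurable_snd.prodMk (hW.comp measurable_fst))))
  have hx : ∀ x : E, Measurable fun A : Rot E => rotInv A x := fun x => by
    have h1 : Continuous fun A : Rot E => ((A⁻¹ : Rot E) : E →L[ℝ] E) :=
      continuous_subtype_val.comp continuous_inv
    exact Continuous.measurable (h1.clm_apply continuous_const)
  calc ∫⁻ p, w p * rotMean G (W p) ∂μ
      = ∫⁻ p, ∫⁻ A : Rot E, w p * G (rotInv A (W p)) ∂rotMeasure ∂μ := by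
        refine lintegral_congr fun p => ?_
        exact (lintegral_const_mul _ (hG.comp (hx (W p)))).symm
    _ = ∫⁻ A : Rot E, ∫⁻ p, w p * G (rotInv A (W p)) ∂μ ∂rotMeasure :=
        lintegral_lintegral_swap hm.aemeasurable
    _ = ∫⁻ p, w p * G (W p) ∂μ := by simp [hinv]

end Rotations

/-! ### The collision kernel as a measure with bounded displacement laws -/

/-- The cosine `σ · q̂` of the deviation angle. -/
def cosAngle {d : ℕ} (p : Vel d × sphere (0 : Vel d) 1) : ℝ := ⟪(p.2 : Vel d), ‖p.1‖⁻¹ • p.1⟫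

lemma measurable_cosAngle {d : ℕ} : Measurable (cosAngle (d := d)) := by
  unfold cosAngle
  fun_prop

lemma abs_cosAngle_le {d : ℕ} (p : Vel d × sphere (0 : Vel d) 1) : |cosAngle p| ≤ 1 := by
  unfold cosAngle
  refine (abs_real_inner_le_norm _ _).trans ?_
  have h2 : ‖(p.2 : Vel d)‖ = 1 := by simp
  rw [h2, one_mul, norm_smul, norm_inv, norm_norm]
  exact inv_mul_le_one

/-- The measure `dq dσ` on `{|q| ≤ R} × S^{d-1}`. -/
def paramMeasure (d : ℕ) (R : ℝ) : Measure (Vel d × sphere (0 : Vel d) 1) :=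
  (volume.restrict (closedBall 0 R)).prod (sphereMeasure d)

instance instFiniteParam (d : ℕ) (R : ℝ) : IsFiniteMeasure (paramMeasure d R) := by
  have : IsFiniteMeasure ((volume : Measure (Vel d)).restrict (closedBall 0 R)) :=
    ⟨by simpa using measure_closedBall_lt_top⟩
  unfold paramMeasure; infer_instance

/-- Simultaneous rotation of `q` and `σ` preserves `dq dσ`. -/
lemma measurePreserving_rotate_param {d : ℕ} (R : ℝ) (U : Vel d ≃ₗᵢ[ℝ] Vel d) :
    MeasurePreserving (Prod.map U (sphereMap U)) (paramMeasure d R) (paramMeasure d R) := by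
  refine MeasurePreserving.prod ?_ (measurePreserving_sphereMap U)
  have h := U.measurePreserving.restrict_preimage (s := closedBall 0 R) measurableSet_closedBall
  have hpre : U ⁻¹' closedBall 0 R = closedBall 0 R := by
    ext x; simp
  rwa [hpre] at h

/-- Dilation by a factor in `[1/2, 1]` keeps the ball inside itself and costs at most `2 ^ d`. -/
lemma setLIntegral_comp_smul_le {d : ℕ} {F : Vel d → ℝ≥0∞} (hF : Measurable F) {R r : ℝ}
    (hr : 1 / 2 ≤ r) (hr1 : r ≤ 1) :
    ∫⁻ q in closedBall 0 R, F (r • q) ≤ 2 ^ d * ∫⁻ q in closedBall 0 R, F q := by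
  have hr0 : 0 < r := by linarith
  calc ∫⁻ q in closedBall 0 R, F (r • q)
      = ∫⁻ q, (closedBall 0 R).indicator (fun q => F (r • q)) q :=
        (lintegral_indicator measurableSet_closedBall _).symm
    _ ≤ ∫⁻ q, (closedBall 0 R).indicator F (r • q) := by
        refine lintegral_mono fun q => ?_
        by_cases hq : q ∈ closedBall (0 : Vel d) R
        · have : r • q ∈ closedBall (0 : Vel d) R := by
            simp only [mem_closedBall, dist_zero_right, norm_smul, Real.norm_eq_abs,
              abs_of_pos hr0] at hq ⊢
            nlinarith [norm_nonneg q]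
          simp [hq, this]
        · simp [hq]
    _ = ∫⁻ q, (closedBall 0 R).indicator F q ∂(Measure.map (r • ·) volume) :=
        (lintegral_map (hF.indicator measurableSet_closedBall) (measurable_const_smul r)).symm
    _ = ENNReal.ofReal (r ^ d)⁻¹ * ∫⁻ q in closedBall 0 R, F q := by
        rw [Measure.map_addHaar_smul _ hr0.ne', lintegral_smul_measure,
          lintegral_indicator measurableSet_closedBall, finrank_euclideanSpace_fin,
          abs_of_pos (by positivity), smul_eq_mul]
    _ ≤ 2 ^ d * ∫⁻ q in closedBall 0 R, F q := by
        gcongr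
        have : (r ^ d)⁻¹ ≤ 2 ^ d := by
          rw [← inv_pow]
          refine pow_le_pow_left₀ (by positivity) ?_ d
          rw [inv_le_comm₀ hr0 two_pos]
          linarith
        calc ENNReal.ofReal (r ^ d)⁻¹ ≤ ENNReal.ofReal (2 ^ d) := ENNReal.ofReal_le_ofReal this
          _ = 2 ^ d := by rw [ENNReal.ofReal_pow two_pos.le]; simp

/-- The law of an equivariant displacement `W` of length comparable to `|q|`, under the measure
`β (σ · q̂) dq dσ`, has bounded density. By rotation invariance `G` may be replaced by its
rotational mean; then the direction of `W` is immaterial, only its length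
`m (σ · q̂) |q|` matters, and the `σ`-integral decouples from the `q`-integral. -/
lemma lintegral_equivariant_le {d : ℕ} {R : ℝ} {β : ℝ → ℝ≥0∞} (hβ : Measurable β)
    (hβ0 : ∀ c < 0, β c = 0) {m : ℝ → ℝ} (hmm : Measurable m)
    (hm : ∀ c ∈ Icc (0 : ℝ) 1, m c ∈ Icc (1 / 2 : ℝ) 1)
    {W : Vel d × sphere (0 : Vel d) 1 → Vel d} (hW : Measurable W)
    (hWU : ∀ (U : Vel d ≃ₗᵢ[ℝ] Vel d) p, W (Prod.map U (sphereMap U) p) = U (W p))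
    (hWn : ∀ p, ‖W p‖ = m (cosAngle p) * ‖p.1‖) {e : Vel d} (he : ‖e‖ = 1)
    {G : Vel d → ℝ≥0∞} (hG : Measurable G) :
    ∫⁻ p, β (cosAngle p) * G (W p) ∂paramMeasure d R ≤
      (2 ^ d * ∫⁻ σ, β ⟪(σ : Vel d), e⟫ ∂sphereMeasure d) * ∫⁻ q in closedBall 0 R, G q := by
  have hcos := measurable_cosAngle (d := d)
  have hmean : ∫⁻ p, β (cosAngle p) * G (W p) ∂paramMeasure d R =
      ∫⁻ p, β (cosAngle p) * rotMean G (W p) ∂paramMeasure d R := by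
    refine (lintegral_mul_rotMean (hβ.comp hcos) hW hG fun U => ?_).symm
    simp only [Function.comp_apply]
    rw [← (measurePreserving_rotate_param R U).lintegral_comp
      (f := fun p => β (cosAngle p) * G (W p)) (by fun_prop)]
    refine lintegral_congr fun p => ?_
    have : cosAngle (Prod.map U (sphereMap U) p) = cosAngle p := by
      simp [cosAngle, sphereMap, inner_smul_right]
    rw [this, hWU]
  have hGm := measurable_rotMean hG
  have hradial : ∀ p : Vel d × sphere (0 : Vel d) 1, β (cosAngle p) * rotMean G (W p) =
      β (cosAngle p) * rotMean G (m (cosAngle p) • p.1) := by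
    intro p
    rcases lt_or_ge (cosAngle p) 0 with h | h
    · simp [hβ0 _ h]
    · congr 1
      -- Both points have norm `m (σ · q̂) |q|`.
      have := (hm _ ⟨h, (abs_le.1 (abs_cosAngle_le p)).2⟩).1
      apply rotMean_eq_of_norm_eq
      rw [hWn, norm_smul, Real.norm_eq_abs, abs_of_nonneg (by linarith)]
  -- At `q = 0` the direction `q̂` is the junk value `0` instead of a unit vector.
  have hnull : ∀ᵐ q : Vel d ∂volume.restrict (closedBall 0 R), q ≠ 0 := by
    have : Nontrivial (Vel d) := by
      refine ⟨e, 0, ?_⟩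
      rintro rfl
      simp at he
    exact ae_restrict_of_ae (by simp [ae_iff])
  calc ∫⁻ p, β (cosAngle p) * G (W p) ∂paramMeasure d R
      = ∫⁻ p, β (cosAngle p) * rotMean G (m (cosAngle p) • p.1) ∂paramMeasure d R := by
        rw [hmean]
        exact lintegral_congr hradial
    _ = ∫⁻ q in closedBall 0 R, ∫⁻ σ, β (cosAngle (q, σ)) * rotMean G (m (cosAngle (q, σ)) • q)
          ∂sphereMeasure d := by
        unfold paramMeasure
        rw [lintegral_prod]
        exact Measurable.aemeasurable (by fun_prop)
    _ = ∫⁻ q in closedBall 0 R, ∫⁻ σ, β ⟪(σ : Vel d), e⟫ * rotMean G (m ⟪(σ : Vel d), e⟫ • q)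
          ∂sphereMeasure d := by
        refine lintegral_congr_ae ?_
        filter_upwards [hnull] with q hq
        refine lintegral_sphere_inner (F := fun c => β c * rotMean G (m c • q))
          (e := ‖q‖⁻¹ • q) (e' := e) ?_
        rw [he, norm_smul, norm_inv, norm_norm, inv_mul_cancel₀ (norm_ne_zero_iff.2 hq)]
    _ = ∫⁻ σ, (∫⁻ q in closedBall (0 : Vel d) R,
          β ⟪(σ : Vel d), e⟫ * rotMean G (m ⟪(σ : Vel d), e⟫ • q)) ∂sphereMeasure d := by
        refine lintegral_lintegral_swap (Measurable.aemeasurable ?_)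
        unfold Function.uncurry
        fun_prop
    _ ≤ ∫⁻ σ, β ⟪(σ : Vel d), e⟫ * (2 ^ d * ∫⁻ q in closedBall 0 R, G q) ∂sphereMeasure d := by
        refine lintegral_mono fun σ => ?_
        dsimp only
        rw [lintegral_const_mul _ (by fun_prop)]
        rcases lt_or_ge ⟪(σ : Vel d), e⟫ 0 with h | h
        · simp [hβ0 _ h]
        · have h1 : ⟪(σ : Vel d), e⟫ ≤ 1 := by
            refine (real_inner_le_norm _ _).trans ?_
            rw [he]; simp
          obtain ⟨hm1, hm2⟩ := hm _ ⟨h, h1⟩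
          gcongr
          refine (setLIntegral_comp_smul_le hGm hm1 hm2).trans_eq ?_
          rw [setLIntegral_rotMean volume (fun U => U.measurePreserving) hG]
    _ = _ := by
        rw [lintegral_mul_const _ (by fun_prop)]
        ring

/-- The displacement `v - v' = (q - |q| σ) / 2`. -/
def disp {d : ℕ} (p : Vel d × sphere (0 : Vel d) 1) : Vel d :=
  (1 / 2 : ℝ) • (p.1 - ‖p.1‖ • (p.2 : Vel d))

/-- The displacement `v - v'_* = (q + |q| σ) / 2`. -/
def dispStar {d : ℕ} (p : Vel d × sphere (0 : Vel d) 1) : Vel d :=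
  (1 / 2 : ℝ) • (p.1 + ‖p.1‖ • (p.2 : Vel d))

lemma continuous_disp {d : ℕ} : Continuous (disp (d := d)) := by unfold disp; fun_prop

lemma continuous_dispStar {d : ℕ} : Continuous (dispStar (d := d)) := by unfold dispStar; fun_prop

lemma dispStar_sub_disp {d : ℕ} (p : Vel d × sphere (0 : Vel d) 1) :
    dispStar p - disp p = ‖p.1‖ • (p.2 : Vel d) := by
  unfold dispStar disp
  module

lemma inner_eq_cosAngle_mul {d : ℕ} (p : Vel d × sphere (0 : Vel d) 1) :
    ⟪p.1, (p.2 : Vel d)⟫ = cosAngle p * ‖p.1‖ := by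
  rw [cosAngle, inner_smul_right, real_inner_comm]
  by_cases h : ‖p.1‖ = 0
  · rw [norm_eq_zero.1 h]; simp
  · field_simp

/-- The half-angle formula `|q + |q| σ| / 2 = |q| cos (θ / 2)`. -/
lemma norm_dispStar {d : ℕ} (p : Vel d × sphere (0 : Vel d) 1) :
    ‖dispStar p‖ = Real.sqrt ((1 + cosAngle p) / 2) * ‖p.1‖ := by
  have hc := abs_le.1 (abs_cosAngle_le p)
  have h1 : ‖p.1 + ‖p.1‖ • (p.2 : Vel d)‖ ^ 2 = 2 * (1 + cosAngle p) * ‖p.1‖ ^ 2 := by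
    rw [norm_add_sq_real, norm_smul, inner_smul_right, inner_eq_cosAngle_mul]
    simp
    ring
  refine (sq_eq_sq₀ (norm_nonneg _) (by positivity)).1 ?_
  rw [dispStar, norm_smul, mul_pow, h1, mul_pow, Real.sq_sqrt (by linarith)]
  norm_num
  ring

/-- The measure `Φ(|q|) b(σ · q̂) dq dσ` on `{|q| ≤ R} × S^{d-1}`. -/
def kernelMeasure (d : ℕ) (Φ b : ℝ → ℝ) (R : ℝ) : Measure (Vel d × sphere (0 : Vel d) 1) :=
  (paramMeasure d R).withDensity fun p => ENNReal.ofReal (Φ ‖p.1‖ * b (cosAngle p))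

/-- The laws of the displacements `v - v'_*`, `v' - v'_*` and `v - v_*` under `κ` have density at
most `C` and are carried by the ball of radius `R`. -/
structure BoundedLaws {d : ℕ} (κ : Measure (Vel d × sphere (0 : Vel d) 1)) (R : ℝ)
    (C : ℝ≥0) : Prop where
  star : ∀ G : Vel d → ℝ≥0∞, Measurable G →
    ∫⁻ p, G (dispStar p) ∂κ ≤ C * ∫⁻ q in closedBall 0 R, G q
  rel : ∀ G : Vel d → ℝ≥0∞, Measurable G →
    ∫⁻ p, G (dispStar p - disp p) ∂κ ≤ C * ∫⁻ q in closedBall 0 R, G q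
  loss : ∀ G : Vel d → ℝ≥0∞, Measurable G →
    ∫⁻ p, G p.1 ∂κ ≤ C * ∫⁻ q in closedBall 0 R, G q

/-- Testing the third law with the constant `1` bounds the total mass. -/
lemma BoundedLaws.isFiniteMeasure {d : ℕ} {κ : Measure (Vel d × sphere (0 : Vel d) 1)} {R : ℝ}
    {C : ℝ≥0} (h : BoundedLaws κ R C) : IsFiniteMeasure κ := by
  refine ⟨lt_of_le_of_lt (b := C * volume (closedBall (0 : Vel d) R)) ?_ ?_⟩
  · simpa using h.loss 1 measurable_one
  · exact ENNReal.mul_lt_top ENNReal.coe_lt_top measure_closedBall_lt_top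

lemma measurable_symmetrized {b : ℝ → ℝ} (hb : Measurable b) : Measurable (symmetrized b) := by
  unfold symmetrized
  exact Measurable.ite measurableSet_Ici (hb.add (hb.comp measurable_neg)) measurable_const

lemma closedBall_subset_cell {d : ℕ} {R L : ℝ} (hRL : R ≤ L) :
    closedBall (0 : Vel d) R ⊆ cell d L := by
  intro v hv i
  have h1 := PiLp.norm_apply_le v i
  rw [Real.norm_eq_abs] at h1
  have h2 : ‖v‖ ≤ R := by simpa using hv
  have := abs_le.1 (h1.trans (h2.trans hRL))
  exact this

lemma exists_ae_bound_of_eLpNorm_top {d : ℕ} {R L : ℝ} (hRL : R ≤ L) {Φ : ℝ → ℝ}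
    (hΦb : eLpNorm ((closedBall (0 : Vel d) R).indicator fun v => Φ ‖v‖) ⊤ (cellMeasure d L) < ⊤) :
    ∃ K : ℝ≥0, ∀ᵐ q ∂(volume : Measure (Vel d)).restrict (closedBall 0 R), Φ ‖q‖ ≤ K := by
  rw [eLpNorm_exponent_top] at hΦb
  refine ⟨(eLpNormEssSup ((closedBall (0 : Vel d) R).indicator fun v => Φ ‖v‖)
    (cellMeasure d L)).toNNReal, ?_⟩
  have h := enorm_ae_le_eLpNormEssSup ((closedBall (0 : Vel d) R).indicator fun v => Φ ‖v‖)
    (cellMeasure d L)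
  have h' := ae_restrict_of_ae_restrict_of_subset (closedBall_subset_cell hRL) h
  filter_upwards [h', ae_restrict_mem measurableSet_closedBall] with q hq hqR
  rw [indicator_of_mem hqR, ← ENNReal.coe_toNNReal hΦb.ne, enorm_le_coe] at hq
  exact (le_abs_self _).trans hq

/-- The three laws are bounded: each displacement is equivariant, and on the support of the
symmetrized kernel `θ ≤ π / 2` keeps `|v - v'_*|` comparable to `|q|`. -/
theorem exists_boundedLaws {d : ℕ} (hd : 2 ≤ d) {R L : ℝ} (hRL : R ≤ L) {Φ b : ℝ → ℝ}
    (hΦm : Measurable Φ) (hΦ : ∀ r, 0 ≤ r → 0 ≤ Φ r)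
    (hΦb : eLpNorm ((closedBall (0 : Vel d) R).indicator fun v => Φ ‖v‖) ⊤ (cellMeasure d L) < ⊤)
    (hbm : Measurable b)
    (hcut : ∀ e : Vel d, ‖e‖ = 1 → Integrable (fun σ : sphere (0 : Vel d) 1 =>
      symmetrized b ⟪(σ : Vel d), e⟫) (sphereMeasure d)) :
    ∃ C : ℝ≥0, BoundedLaws (kernelMeasure d Φ (symmetrized b) R) R C := by
  obtain ⟨K, hK⟩ := exists_ae_bound_of_eLpNorm_top hRL hΦb
  set e : Vel d := EuclideanSpace.single ⟨0, by omega⟩ 1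
  have he : ‖e‖ = 1 := by simp [e]
  set β : ℝ → ℝ≥0∞ := fun c => ENNReal.ofReal (symmetrized b c) with hβdef
  have hsm := measurable_symmetrized hbm
  have hβ : Measurable β := by fun_prop
  have hβ0 : ∀ c < 0, β c = 0 := fun c hc => by simp [hβdef, symmetrized, not_le.2 hc]
  have hfin : ∫⁻ σ, β ⟪(σ : Vel d), e⟫ ∂sphereMeasure d ≠ ⊤ := (hcut e he).lintegral_lt_top.ne
  set A := (2 ^ d * ∫⁻ σ, β ⟪(σ : Vel d), e⟫ ∂sphereMeasure d) with hA
  have hAfin : A ≠ ⊤ := ENNReal.mul_ne_top (by simp) hfin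
  have hcos := measurable_cosAngle (d := d)
  have key : ∀ (m : ℝ → ℝ), Measurable m → (∀ c ∈ Icc (0 : ℝ) 1, m c ∈ Icc (1 / 2 : ℝ) 1) →
      ∀ W : Vel d × sphere (0 : Vel d) 1 → Vel d, Measurable W →
      (∀ (U : Vel d ≃ₗᵢ[ℝ] Vel d) p, W (Prod.map U (sphereMap U) p) = U (W p)) →
      (∀ p, ‖W p‖ = m (cosAngle p) * ‖p.1‖) → ∀ G : Vel d → ℝ≥0∞, Measurable G →
      ∫⁻ p, G (W p) ∂kernelMeasure d Φ (symmetrized b) R ≤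
        (K * A.toNNReal : ℝ≥0) * ∫⁻ q in closedBall 0 R, G q := by
    intro m hmm hm W hW hWU hWn G hG
    have hKp : ∀ᵐ p ∂paramMeasure d R, Φ ‖p.1‖ ≤ K :=
      Measure.quasiMeasurePreserving_fst.ae hK
    calc ∫⁻ p, G (W p) ∂kernelMeasure d Φ (symmetrized b) R
        = ∫⁻ p, ENNReal.ofReal (Φ ‖p.1‖ * symmetrized b (cosAngle p)) * G (W p)
            ∂paramMeasure d R := by
          rw [kernelMeasure, lintegral_withDensity_eq_lintegral_mul _ (by fun_prop) (by fun_prop)]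
          rfl
      _ ≤ ∫⁻ p, K * (β (cosAngle p) * G (W p)) ∂paramMeasure d R := by
          refine lintegral_mono_ae ?_
          filter_upwards [hKp] with p hp
          rw [← mul_assoc, ENNReal.ofReal_mul (hΦ _ (norm_nonneg _))]
          gcongr
          exact ENNReal.ofReal_le_of_le_toReal (by simpa using hp)
      _ = K * ∫⁻ p, β (cosAngle p) * G (W p) ∂paramMeasure d R :=
          lintegral_const_mul _ (by fun_prop)
      _ ≤ K * (A * ∫⁻ q in closedBall 0 R, G q) := by
          gcongr
          exact lintegral_equivariant_le hβ hβ0 hmm hm hW hWU hWn he hG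
      _ = _ := by
          rw [ENNReal.coe_mul, ENNReal.coe_toNNReal hAfin]
          exact (mul_assoc _ _ _).symm
  have hone : ∀ c ∈ Icc (0 : ℝ) 1, (fun _ : ℝ => (1 : ℝ)) c ∈ Icc (1 / 2 : ℝ) 1 := by
    intro c _; norm_num
  refine ⟨K * A.toNNReal, ?_, ?_, ?_⟩
  · refine key (fun c => Real.sqrt ((1 + c) / 2)) (by fun_prop) ?_ dispStar
      continuous_dispStar.measurable ?_ norm_dispStar
    · intro c hc
      refine ⟨Real.le_sqrt_of_sq_le ?_, Real.sqrt_le_one.2 ?_⟩ <;> linarith [hc.1, hc.2]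
    · intro U p
      simp [dispStar, sphereMap]
  · refine key _ measurable_const hone (fun p => dispStar p - disp p)
      (continuous_dispStar.sub continuous_disp).measurable ?_ ?_
    · intro U p
      simp only [dispStar_sub_disp]
      simp [sphereMap]
    · intro p
      simp [dispStar_sub_disp, norm_smul]
  · exact key _ measurable_const hone Prod.fst measurable_fst (fun U p => rfl) (fun p => by simp)

lemma symmetrized_nonneg {b : ℝ → ℝ} (hb : ∀ c ∈ Icc (-1 : ℝ) 1, 0 ≤ b c) {c : ℝ} (hc : |c| ≤ 1) :
    0 ≤ symmetrized b c := by
  have h := abs_le.1 hc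
  unfold symmetrized
  split_ifs
  · exact add_nonneg (hb c h) (hb (-c) ⟨by linarith, by linarith⟩)
  · exact le_rfl

/-- The collision operator as an integral against `kernelMeasure`. -/
theorem collision_eq_integral {d : ℕ} {R : ℝ} {Φ b : ℝ → ℝ}
    (hΦm : Measurable Φ) (hΦ : ∀ r, 0 ≤ r → 0 ≤ Φ r)
    (hbm : Measurable b) (hb : ∀ c ∈ Icc (-1 : ℝ) 1, 0 ≤ b c)
    [IsFiniteMeasure (kernelMeasure d Φ (symmetrized b) R)]
    {g f : Vel d → ℝ} (hg : Continuous g) (hf : Continuous f)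
    (hgb : ∃ B, ∀ v, |g v| ≤ B) (hfb : ∃ B, ∀ v, |f v| ≤ B) (v : Vel d) :
    collision Φ (symmetrized b) R g f v =
      ∫ p, (g (v - dispStar p) * f (v - disp p) - g (v - p.1) * f v)
        ∂kernelMeasure d Φ (symmetrized b) R := by
  have hsm := measurable_symmetrized hbm
  have hcos := measurable_cosAngle (d := d)
  have hdm : Measurable fun p : Vel d × sphere (0 : Vel d) 1 =>
      ENNReal.ofReal (Φ ‖p.1‖ * symmetrized b (cosAngle p)) := by fun_prop
  set F : Vel d × sphere (0 : Vel d) 1 → ℝ :=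
    fun p => g (v - dispStar p) * f (v - disp p) - g (v - p.1) * f v with hF
  have hFc : Continuous F := by
    have h1 := continuous_disp (d := d)
    have h2 := continuous_dispStar (d := d)
    fun_prop
  obtain ⟨B, hB⟩ := hgb
  obtain ⟨B', hB'⟩ := hfb
  have hFb : ∀ p, ‖F p‖ ≤ B * B' + B * B' := fun p => by
    have hB0 : 0 ≤ B := (abs_nonneg _).trans (hB 0)
    refine (norm_sub_le _ _).trans (add_le_add ?_ ?_) <;>
    · rw [norm_mul]
      exact mul_le_mul (hB _) (hB' _) (norm_nonneg _) hB0
  have hFi : Integrable F (kernelMeasure d Φ (symmetrized b) R) :=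
    Integrable.of_bound hFc.aestronglyMeasurable _ (Filter.Eventually.of_forall hFb)
  have htop : ∀ᵐ p ∂paramMeasure d R,
      ENNReal.ofReal (Φ ‖p.1‖ * symmetrized b (cosAngle p)) < ⊤ := by simp
  have htr : ∀ p : Vel d × sphere (0 : Vel d) 1,
      (ENNReal.ofReal (Φ ‖p.1‖ * symmetrized b (cosAngle p))).toReal =
        Φ ‖p.1‖ * symmetrized b (cosAngle p) := fun p =>
    ENNReal.toReal_ofReal (mul_nonneg (hΦ _ (norm_nonneg _))
      (symmetrized_nonneg hb (abs_cosAngle_le p)))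
  rw [kernelMeasure, integral_withDensity_eq_integral_toReal_smul hdm htop]
  rw [kernelMeasure, integrable_withDensity_iff_integrable_smul' hdm htop] at hFi
  simp only [htr] at hFi ⊢
  rw [paramMeasure] at hFi ⊢
  rw [integral_prod _ hFi]
  rfl

/-! ### Translation invariance of the integral over the period cell -/

/-- `2L`-periodicity in every coordinate direction. -/
def IsPeriodic {d : ℕ} {α : Type*} (L : ℝ) (f : Vel d → α) : Prop :=
  ∀ (i : Fin d) (v : Vel d), f (v + EuclideanSpace.single i (2 * L)) = f v

/-- The basis `2L e_i` of the period lattice. -/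
def latticeBasis (d : ℕ) {L : ℝ} (hL : 0 < L) : Module.Basis (Fin d) ℝ (Vel d) :=
  (EuclideanSpace.basisFun (Fin d) ℝ).toBasis.isUnitSMul (w := fun _ => 2 * L)
    fun _ => (by positivity : (2 * L) ≠ 0).isUnit

lemma latticeBasis_apply {d : ℕ} {L : ℝ} (hL : 0 < L) (i : Fin d) :
    latticeBasis d hL i = EuclideanSpace.single i (2 * L) := by
  rw [latticeBasis, Module.Basis.isUnitSMul_apply]
  ext j
  simp [EuclideanSpace.basisFun_apply]

lemma latticeBasis_repr {d : ℕ} {L : ℝ} (hL : 0 < L) (v : Vel d) (i : Fin d) :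
    (latticeBasis d hL).repr v i = (2 * L)⁻¹ * v i := by
  rw [latticeBasis, Module.Basis.repr_isUnitSMul]
  simp [Units.smul_def]

lemma IsPeriodic.vadd {d : ℕ} {α : Type*} {L : ℝ} (hL : 0 < L) {f : Vel d → α}
    (hf : IsPeriodic L f) (g : Submodule.span ℤ (range (latticeBasis d hL))) (v : Vel d) :
    f (g +ᵥ v) = f v := by
  obtain ⟨g, hg⟩ := g
  change f (g + v) = f v
  induction hg using Submodule.span_induction generalizing v with
  | mem x hx =>
    obtain ⟨i, rfl⟩ := hx
    rw [latticeBasis_apply, add_comm, hf]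
  | zero => simp
  | add x y _ _ hx hy => rw [add_assoc, hx, hy]
  | smul a x _ hx =>
    have hneg : ∀ w, f (-x + w) = f w := fun w => by
      rw [← hx (-x + w)]; simp
    induction a using Int.induction_on generalizing v with
    | zero => simp
    | succ n ih => rw [add_smul, one_smul, add_assoc, ih, hx]
    | pred n ih => rw [sub_smul, one_smul, sub_eq_add_neg, add_assoc, ih, hneg]

/-- The half-open box `[-L, L)^d - w`. All these boxes are fundamental domains of the period
lattice, and they agree with the translates of the cell up to null sets. -/
def shiftedBox (d : ℕ) (L : ℝ) (w : Vel d) : Set (Vel d) :=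
  {v | ∀ i, v i + w i ∈ Ico (-L) L}

lemma isAddFundamentalDomain_shiftedBox {d : ℕ} {L : ℝ} (hL : 0 < L) (w : Vel d) :
    IsAddFundamentalDomain (Submodule.span ℤ (range (latticeBasis d hL))) (shiftedBox d L w)
      volume := by
  refine IsAddFundamentalDomain.mk' (MeasurableSet.nullMeasurableSet ?_) fun x => ?_
  · have : shiftedBox d L w = ⋂ i, (fun v : Vel d => v i + w i) ⁻¹' Ico (-L) L := by
      ext; simp [shiftedBox]
    rw [this]
    exact MeasurableSet.iInter fun i =>
      (by fun_prop : Measurable fun v : Vel d => v i + w i) measurableSet_Ico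
  -- Shifting by `w + (L, …, L)` carries the box to the standard fundamental domain.
  · have h := ZSpan.exist_unique_vadd_mem_fundamentalDomain (latticeBasis d hL)
      (x + (w + WithLp.toLp 2 fun _ => L))
    convert h using 2 with g
    simp only [shiftedBox, mem_ofPred_eq, ZSpan.mem_fundamentalDomain, latticeBasis_repr]
    refine forall_congr' fun i => ?_
    change (g : Vel d) i + x i + w i ∈ _ ↔
      (2 * L)⁻¹ * ((g : Vel d) i + (x i + (w i + L))) ∈ _
    rw [mem_Ico, mem_Ico, inv_mul_lt_iff₀ (by positivity)]
    refine and_congr ?_ ?_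
    · rw [mul_nonneg_iff_of_pos_left (by positivity)]
      constructor <;> intro h <;> linarith
    · constructor <;> intro h <;> linarith

lemma measurePreserving_ofLp (d : ℕ) :
    MeasurePreserving (fun v : Vel d => (fun i => v i : Fin d → ℝ)) volume volume :=
  PiLp.volume_preserving_ofLp (Fin d)

lemma cell_eq_preimage (d : ℕ) (L : ℝ) :
    cell d L = (fun v : Vel d => (fun i => v i : Fin d → ℝ)) ⁻¹' Icc (fun _ => -L) fun _ => L := by
  ext v
  simp [cell, Pi.le_def, forall_and]

lemma shiftedBox_ae_eq {d : ℕ} {L : ℝ} (w : Vel d) :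
    shiftedBox d L w =ᵐ[volume] (fun v => v + w) ⁻¹' cell d L := by
  have h0 : shiftedBox d L w = (fun v : Vel d => v + w) ⁻¹'
      ((fun v : Vel d => (fun i => v i : Fin d → ℝ)) ⁻¹'
        (Set.pi univ fun _ => Ico (-L) L)) := by
    ext v
    simp [shiftedBox]
  rw [h0, cell_eq_preimage]
  exact (measurePreserving_add_right volume w).quasiMeasurePreserving.preimage_ae_eq
    ((measurePreserving_ofLp d).quasiMeasurePreserving.preimage_ae_eq
      Measure.univ_pi_Ico_ae_eq_Icc)

instance instVAddInvariantLattice {d : ℕ} {L : ℝ} (hL : 0 < L) :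
    VAddInvariantMeasure (Submodule.span ℤ (range (latticeBasis d hL))) (Vel d) volume :=
  inferInstanceAs <|
    VAddInvariantMeasure (Submodule.span ℤ (range (latticeBasis d hL))).toAddSubgroup (Vel d) volume

/-- The integral of a periodic function over the cell is translation invariant. -/
lemma lintegral_cell_add {d : ℕ} {L : ℝ} (hL : 0 < L) {f : Vel d → ℝ≥0∞}
    (hf : IsPeriodic L f) (w : Vel d) :
    ∫⁻ v, f (v + w) ∂cellMeasure d L = ∫⁻ v, f v ∂cellMeasure d L := by
  have h := (isAddFundamentalDomain_shiftedBox hL 0).setLIntegral_eq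
    (isAddFundamentalDomain_shiftedBox hL (-w)) f fun g x => hf.vadd hL g x
  rw [setLIntegral_congr (shiftedBox_ae_eq 0), setLIntegral_congr (shiftedBox_ae_eq (-w))] at h
  have hmp := measurePreserving_add_right (volume : Measure (Vel d)) w
  have h2 := hmp.setLIntegral_comp_preimage_emb (measurableEmbedding_addRight w) f
    ((fun v => v + -w) ⁻¹' cell d L)
  rw [← h] at h2
  simpa [preimage_preimage, cellMeasure] using h2

lemma integral_cell_add {d : ℕ} {L : ℝ} (hL : 0 < L) {f : Vel d → ℂ}
    (hf : IsPeriodic L f) (w : Vel d) :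
    ∫ v, f (v + w) ∂cellMeasure d L = ∫ v, f v ∂cellMeasure d L := by
  have h := (isAddFundamentalDomain_shiftedBox hL 0).setIntegral_eq
    (isAddFundamentalDomain_shiftedBox hL (-w)) (f := f) fun g x => hf.vadd hL g x
  rw [setIntegral_congr_set (shiftedBox_ae_eq 0),
    setIntegral_congr_set (shiftedBox_ae_eq (-w))] at h
  have h2 := (measurePreserving_add_right (volume : Measure (Vel d)) w).setIntegral_preimage_emb
    (measurableEmbedding_addRight w) f ((fun v => v + -w) ⁻¹' cell d L)
  rw [← h] at h2
  simpa [preimage_preimage, cellMeasure] using h2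

lemma volume_cell {d : ℕ} {L : ℝ} (hL : 0 < L) :
    volume (cell d L) = ENNReal.ofReal ((2 * L) ^ d) := by
  rw [cell_eq_preimage, (measurePreserving_ofLp d).measure_preimage
    measurableSet_Icc.nullMeasurableSet, Real.volume_Icc_pi]
  rw [ENNReal.ofReal_pow (by positivity)]
  simp [two_mul]

instance instFiniteCellMeasure (d : ℕ) (L : ℝ) : IsFiniteMeasure (cellMeasure d L) := by
  refine ⟨?_⟩
  rw [cellMeasure, Measure.restrict_apply_univ, cell_eq_preimage,
    (measurePreserving_ofLp d).measure_preimage measurableSet_Icc.nullMeasurableSet]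
  exact isCompact_Icc.measure_lt_top

lemma lintegral_cell_neg {d : ℕ} {L : ℝ} (f : Vel d → ℝ≥0∞) :
    ∫⁻ v, f (-v) ∂cellMeasure d L = ∫⁻ v, f v ∂cellMeasure d L := by
  have hmp := Measure.measurePreserving_neg (volume : Measure (Vel d))
  have h := hmp.setLIntegral_comp_preimage_emb (MeasurableEquiv.neg (Vel d)).measurableEmbedding f
    (cell d L)
  have hs : Neg.neg ⁻¹' cell d L = cell d L := by
    ext v
    simp only [cell, mem_preimage, mem_ofPred_eq, PiLp.neg_apply, mem_Icc]
    refine forall_congr' fun i => ?_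
    constructor <;> rintro ⟨h1, h2⟩ <;> constructor <;> linarith
  rwa [hs] at h

/-! ### Bilinear estimates for the collision operator -/

/-- The Cauchy–Schwarz inequality with respect to the measure of density `a`. -/
lemma sq_lintegral_mul_le {P : Type*} [MeasurableSpace P] {μ : Measure P} {a b : P → ℝ≥0∞}
    (ha : Measurable a) (hb : Measurable b) :
    (∫⁻ p, a p * b p ∂μ) ^ 2 ≤ (∫⁻ p, a p ∂μ) * ∫⁻ p, a p * b p ^ 2 ∂μ := by
  have h := ENNReal.lintegral_mul_le_Lp_mul_Lq μ Real.HolderConjugate.two_two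
    (f := fun p => a p ^ (1 / 2 : ℝ)) (g := fun p => a p ^ (1 / 2 : ℝ) * b p)
    (by fun_prop) (by fun_prop)
  have h1 : ∀ p, a p ^ (1 / 2 : ℝ) * (a p ^ (1 / 2 : ℝ) * b p) = a p * b p := fun p => by
    rw [← mul_assoc, ← ENNReal.rpow_add_of_nonneg _ _ (by norm_num) (by norm_num)]
    norm_num
  have h2 : ∀ p, (a p ^ (1 / 2 : ℝ)) ^ (2 : ℝ) = a p := fun p => by
    rw [← ENNReal.rpow_mul]; norm_num
  have h3 : ∀ p, (a p ^ (1 / 2 : ℝ) * b p) ^ (2 : ℝ) = a p * b p ^ 2 := fun p => by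
    rw [ENNReal.mul_rpow_of_nonneg _ _ (by norm_num), h2]; norm_num
  simp only [Pi.mul_apply, h1, h2, h3] at h
  calc (∫⁻ p, a p * b p ∂μ) ^ 2
      ≤ ((∫⁻ p, a p ∂μ) ^ (1 / 2 : ℝ) * (∫⁻ p, a p * b p ^ 2 ∂μ) ^ (1 / 2 : ℝ)) ^ 2 := by gcongr
    _ = _ := by
      rw [mul_pow]
      simp only [← ENNReal.rpow_natCast, ← ENNReal.rpow_mul]
      norm_num

section Laws

variable {d : ℕ} {κ : Measure (Vel d × sphere (0 : Vel d) 1)} {R L : ℝ} {C : ℝ≥0}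

lemma restrict_ball_le_cellMeasure (hRL : R ≤ L) :
    (volume : Measure (Vel d)).restrict (closedBall 0 R) ≤ cellMeasure d L :=
  Measure.restrict_mono_set _ (closedBall_subset_cell hRL)

lemma lintegral_cell_sub_left (hL : 0 < L) {F : Vel d → ℝ≥0∞} (hF : IsPeriodic L F) (v : Vel d) :
    ∫⁻ q, F (v - q) ∂cellMeasure d L = ∫⁻ q, F q ∂cellMeasure d L := by
  have h1 := lintegral_cell_neg (L := L) fun q => F (v + q)
  have h2 := lintegral_cell_add hL hF v
  simp only [← sub_eq_add_neg] at h1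
  rw [h1, ← h2]
  simp only [add_comm]

lemma BoundedLaws.lintegral_star_le (h : BoundedLaws κ R C) (hL : 0 < L) (hRL : R ≤ L)
    {F : Vel d → ℝ≥0∞} (hFm : Measurable F) (hF : IsPeriodic L F) (v : Vel d) :
    ∫⁻ p, F (v - dispStar p) ∂κ ≤ C * ∫⁻ q, F q ∂cellMeasure d L := by
  rw [← lintegral_cell_sub_left hL hF v]
  refine (h.star (fun q => F (v - q)) (by fun_prop)).trans ?_
  gcongr
  exact restrict_ball_le_cellMeasure hRL

lemma BoundedLaws.lintegral_loss_le (h : BoundedLaws κ R C) (hL : 0 < L) (hRL : R ≤ L)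
    {F : Vel d → ℝ≥0∞} (hFm : Measurable F) (hF : IsPeriodic L F) (v : Vel d) :
    ∫⁻ p, F (v - p.1) ∂κ ≤ C * ∫⁻ q, F q ∂cellMeasure d L := by
  rw [← lintegral_cell_sub_left hL hF v]
  refine (h.loss (fun q => F (v - q)) (by fun_prop)).trans ?_
  gcongr
  exact restrict_ball_le_cellMeasure hRL

lemma BoundedLaws.lintegral_rel_le (h : BoundedLaws κ R C) (hL : 0 < L) (hRL : R ≤ L)
    {F : Vel d → ℝ≥0∞} (hFm : Measurable F) (hF : IsPeriodic L F) (v : Vel d) :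
    ∫⁻ p, F (v + (dispStar p - disp p)) ∂κ ≤ C * ∫⁻ q, F q ∂cellMeasure d L := by
  rw [← lintegral_cell_add hL hF v]
  simp only [add_comm v]
  refine (h.rel (fun q => F (q + v)) (by fun_prop)).trans ?_
  gcongr
  exact restrict_ball_le_cellMeasure hRL

/-- The `L²` estimate of the gain term. After Cauchy–Schwarz with weight `g(v'_*)`, translating
`v` by `v - v'_*` leaves only the law of `v' - v'_*`. -/
lemma BoundedLaws.lintegral_gain_sq_le (h : BoundedLaws κ R C) (hL : 0 < L) (hRL : R ≤ L)
    {g f : Vel d → ℝ≥0∞} (hgm : Measurable g) (hfm : Measurable f) (hg : IsPeriodic L g)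
    (hf : IsPeriodic L f) :
    ∫⁻ v, (∫⁻ p, g (v - dispStar p) * f (v - disp p) ∂κ) ^ 2 ∂cellMeasure d L ≤
      (C * ∫⁻ v, g v ∂cellMeasure d L) ^ 2 * ∫⁻ v, f v ^ 2 ∂cellMeasure d L := by
  have := h.isFiniteMeasure
  have hd1 := (continuous_disp (d := d)).measurable
  have hd2 := (continuous_dispStar (d := d)).measurable
  have hf2 : IsPeriodic L fun v => f v ^ 2 := fun i v => by simp only [hf i v]
  calc ∫⁻ v, (∫⁻ p, g (v - dispStar p) * f (v - disp p) ∂κ) ^ 2 ∂cellMeasure d L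
      ≤ ∫⁻ v, (C * ∫⁻ v, g v ∂cellMeasure d L) *
          (∫⁻ p, g (v - dispStar p) * f (v - disp p) ^ 2 ∂κ) ∂cellMeasure d L := by
        refine lintegral_mono fun v => (sq_lintegral_mul_le (by fun_prop) (by fun_prop)).trans ?_
        gcongr
        exact h.lintegral_star_le hL hRL hgm hg v
    _ = (C * ∫⁻ v, g v ∂cellMeasure d L) *
          ∫⁻ v, ∫⁻ p, g (v - dispStar p) * f (v - disp p) ^ 2 ∂κ ∂cellMeasure d L := by
        refine lintegral_const_mul _ ?_
        exact Measurable.lintegral_prod_right'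
          (f := fun z : Vel d × (Vel d × sphere (0 : Vel d) 1) =>
            g (z.1 - dispStar z.2) * f (z.1 - disp z.2) ^ 2) (by fun_prop)
    _ = (C * ∫⁻ v, g v ∂cellMeasure d L) *
          ∫⁻ p, (∫⁻ v, g (v - dispStar p) * f (v - disp p) ^ 2 ∂cellMeasure d L) ∂κ := by
        rw [lintegral_lintegral_swap]
        exact Measurable.aemeasurable (by unfold Function.uncurry; fun_prop)
    _ = (C * ∫⁻ v, g v ∂cellMeasure d L) *
          ∫⁻ p, (∫⁻ v, g v * f (v + (dispStar p - disp p)) ^ 2 ∂cellMeasure d L) ∂κ := by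
        congr 1
        refine lintegral_congr fun p => ?_
        have hper : IsPeriodic L fun v => g (v - dispStar p) * f (v - disp p) ^ 2 := fun i v => by
          simp only [add_sub_right_comm, hg i, hf i]
        rw [← lintegral_cell_add hL hper (dispStar p)]
        refine lintegral_congr fun v => ?_
        simp only [add_sub_cancel_right, add_sub_assoc]
    _ = (C * ∫⁻ v, g v ∂cellMeasure d L) *
          ∫⁻ v, g v * (∫⁻ p, f (v + (dispStar p - disp p)) ^ 2 ∂κ) ∂cellMeasure d L := by
        rw [lintegral_lintegral_swap]
        · congr 1
          refine lintegral_congr fun v => ?_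
          rw [lintegral_const_mul _ (by fun_prop)]
        · exact Measurable.aemeasurable (by unfold Function.uncurry; fun_prop)
    _ ≤ (C * ∫⁻ v, g v ∂cellMeasure d L) *
          ∫⁻ v, g v * (C * ∫⁻ v, f v ^ 2 ∂cellMeasure d L) ∂cellMeasure d L := by
        gcongr with v
        exact h.lintegral_rel_le hL hRL (by fun_prop) hf2 v
    _ = _ := by
        rw [lintegral_mul_const _ hgm]
        ring

end Laws

/-- The class of bounded continuous periodic functions, which contains the real trigonometric
polynomials and their negative parts. -/
structure IsTame {d : ℕ} (L : ℝ) (f : Vel d → ℝ) : Prop where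
  cont : Continuous f
  bdd : ∃ B, ∀ v, |f v| ≤ B
  per : IsPeriodic L f

section Tame

variable {d : ℕ} {L : ℝ} {f g : Vel d → ℝ}

lemma IsTame.add (hf : IsTame L f) (hg : IsTame L g) : IsTame L fun v => f v + g v := by
  obtain ⟨B, hB⟩ := hf.bdd
  obtain ⟨B', hB'⟩ := hg.bdd
  exact ⟨hf.cont.add hg.cont, ⟨B + B', fun v => (abs_add_le _ _).trans (add_le_add (hB v) (hB' v))⟩,
    fun i v => by simp only [hf.per i v, hg.per i v]⟩

lemma IsTame.mul (hf : IsTame L f) (hg : IsTame L g) : IsTame L fun v => f v * g v := by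
  obtain ⟨B, hB⟩ := hf.bdd
  obtain ⟨B', hB'⟩ := hg.bdd
  refine ⟨hf.cont.mul hg.cont, ⟨B * B', fun v => ?_⟩,
    fun i v => by simp only [hf.per i v, hg.per i v]⟩
  rw [abs_mul]
  exact mul_le_mul (hB v) (hB' v) (abs_nonneg _) ((abs_nonneg _).trans (hB v))

lemma IsTame.neg (hf : IsTame L f) : IsTame L fun v => -f v := by
  obtain ⟨B, hB⟩ := hf.bdd
  exact ⟨hf.cont.neg, ⟨B, fun v => by simpa using hB v⟩, fun i v => by simp only [hf.per i v]⟩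

lemma IsTame.sub (hf : IsTame L f) (hg : IsTame L g) : IsTame L fun v => f v - g v := by
  simpa only [sub_eq_add_neg] using hf.add hg.neg

lemma IsTame.abs (hf : IsTame L f) : IsTame L fun v => |f v| := by
  obtain ⟨B, hB⟩ := hf.bdd
  exact ⟨hf.cont.abs, ⟨B, fun v => by simpa using hB v⟩, fun i v => by simp only [hf.per i v]⟩

lemma IsTame.negativePart (hf : IsTame L f) : IsTame L (negativePart f) := by
  obtain ⟨B, hB⟩ := hf.bdd
  refine ⟨hf.cont.neg.max continuous_const, ⟨B, fun v => ?_⟩, fun i v => by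
    simp only [FourierBoltzmann.negativePart, hf.per i v]⟩
  have h1 := abs_le.1 (hB v)
  have h2 := (abs_nonneg _).trans (hB v)
  rw [FourierBoltzmann.negativePart, abs_of_nonneg (le_max_right _ _)]
  exact max_le (by linarith) h2

lemma IsTame.memLp (hf : IsTame L f) (p : ℝ≥0∞) : MemLp f p (cellMeasure d L) := by
  obtain ⟨B, hB⟩ := hf.bdd
  exact MemLp.of_bound hf.cont.aestronglyMeasurable B (Filter.Eventually.of_forall hB)

lemma IsTame.integrable (hf : IsTame L f) : Integrable f (cellMeasure d L) :=
  memLp_one_iff_integrable.1 (hf.memLp 1)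

lemma normL1_eq (hf : IsTame L f) : normL1 L f = ∫ v, |f v| ∂cellMeasure d L := by
  rw [normL1, lpNorm_one_eq_integral_norm hf.cont.aestronglyMeasurable]
  rfl

lemma normL2_sq (hf : IsTame L f) : normL2 L f ^ 2 = ∫ v, f v ^ 2 ∂cellMeasure d L := by
  rw [normL2, lpNorm_eq_integral_norm_rpow_toReal (by simp) (by simp) hf.cont.aestronglyMeasurable]
  simp only [ENNReal.toReal_ofNat, Real.rpow_two, Real.norm_eq_abs, sq_abs]
  rw [← Real.rpow_natCast, ← Real.rpow_mul (integral_nonneg fun v => sq_nonneg _)]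
  norm_num

lemma lintegral_enorm_eq (hf : IsTame L f) :
    ∫⁻ v, ‖f v‖ₑ ∂cellMeasure d L = ENNReal.ofReal (normL1 L f) := by
  rw [normL1_eq hf, ofReal_integral_eq_lintegral_ofReal hf.abs.integrable
    (Filter.Eventually.of_forall fun v => abs_nonneg _)]
  simp only [Real.enorm_eq_ofReal_abs]

lemma lintegral_enorm_sq_eq (hf : IsTame L f) :
    ∫⁻ v, ‖f v‖ₑ ^ 2 ∂cellMeasure d L = ENNReal.ofReal (normL2 L f ^ 2) := by
  rw [normL2_sq hf, ofReal_integral_eq_lintegral_ofReal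
    (by simpa only [sq] using (hf.mul hf).integrable)
    (Filter.Eventually.of_forall fun v => sq_nonneg _)]
  simp only [Real.enorm_eq_ofReal_abs, ← ENNReal.ofReal_pow (abs_nonneg _), sq_abs]

lemma normL1_nonneg : 0 ≤ normL1 L f := lpNorm_nonneg
lemma normL2_nonneg : 0 ≤ normL2 L f := lpNorm_nonneg

/-- The Cauchy–Schwarz inequality on the cell. -/
lemma abs_integral_mul_le (hf : IsTame L f) (hg : IsTame L g) :
    |∫ v, f v * g v ∂cellMeasure d L| ≤ normL2 L f * normL2 L g := by
  have h1 : ENNReal.ofReal |∫ v, f v * g v ∂cellMeasure d L| ≤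
      ENNReal.ofReal (normL2 L f * normL2 L g) := by
    rw [← Real.enorm_eq_ofReal_abs]
    refine (enorm_integral_le_lintegral_enorm _).trans ?_
    have h := ENNReal.lintegral_mul_le_Lp_mul_Lq (cellMeasure d L) Real.HolderConjugate.two_two
      (f := fun v => ‖f v‖ₑ) (g := fun v => ‖g v‖ₑ)
      hf.cont.measurable.enorm.aemeasurable hg.cont.measurable.enorm.aemeasurable
    simp only [Pi.mul_apply, ENNReal.rpow_two, lintegral_enorm_sq_eq hf,
      lintegral_enorm_sq_eq hg] at h
    simp only [enorm_mul]
    refine h.trans_eq ?_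
    rw [ENNReal.ofReal_rpow_of_nonneg (sq_nonneg _) (by norm_num),
      ENNReal.ofReal_rpow_of_nonneg (sq_nonneg _) (by norm_num), ENNReal.ofReal_mul normL2_nonneg,
      ← Real.sqrt_eq_rpow, ← Real.sqrt_eq_rpow, Real.sqrt_sq normL2_nonneg,
      Real.sqrt_sq normL2_nonneg]
  exact (ENNReal.ofReal_le_ofReal_iff (mul_nonneg normL2_nonneg normL2_nonneg)).1 h1

lemma isTame_const (c : ℝ) : IsTame L fun _ : Vel d => c :=
  ⟨continuous_const, ⟨|c|, fun _ => le_rfl⟩, fun _ _ => rfl⟩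

/-- The constant `(2L)^{d/2}` of the embedding of `L²` into `L¹`. -/
lemma normL1_le (hL : 0 < L) (hf : IsTame L f) :
    normL1 L f ≤ Real.sqrt ((2 * L) ^ d) * normL2 L f := by
  have h := abs_integral_mul_le hf.abs (isTame_const (L := L) (d := d) 1)
  have h1 : normL2 L (fun _ : Vel d => (1 : ℝ)) = Real.sqrt ((2 * L) ^ d) := by
    rw [← Real.sqrt_sq (normL2_nonneg (L := L) (f := fun _ : Vel d => (1 : ℝ))),
      normL2_sq (isTame_const 1)]
    congr 1
    simp [cellMeasure, Measure.real, volume_cell hL, hL.le]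
  have h2 : normL2 L (fun v => |f v|) = normL2 L f :=
    lpNorm_fun_abs hf.cont.aestronglyMeasurable 2
  rw [h1, h2] at h
  simp only [mul_one] at h
  rw [normL1_eq hf, mul_comm]
  exact (le_abs_self _).trans h

lemma normL2_add_le (hf : IsTame L f) (g : Vel d → ℝ) :
    normL2 L (fun v => f v + g v) ≤ normL2 L f + normL2 L g :=
  lpNorm_add_le (hf.memLp 2) (by norm_num)

lemma normL2_le_of_lintegral (hf : IsTame L f) {a : ℝ} (ha : 0 ≤ a)
    (h : ∫⁻ v, ‖f v‖ₑ ^ 2 ∂cellMeasure d L ≤ ENNReal.ofReal (a ^ 2)) : normL2 L f ≤ a := by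
  rw [lintegral_enorm_sq_eq hf, ENNReal.ofReal_le_ofReal_iff (sq_nonneg _)] at h
  exact (sq_le_sq₀ normL2_nonneg ha).1 h

end Tame

section Operators

variable {d : ℕ} {κ : Measure (Vel d × sphere (0 : Vel d) 1)} {R L : ℝ} {C : ℝ≥0}

/-- The gain term `∫ g(v'_*) f(v') dκ`. -/
def gain (κ : Measure (Vel d × sphere (0 : Vel d) 1)) (g f : Vel d → ℝ) (v : Vel d) : ℝ :=
  ∫ p, g (v - dispStar p) * f (v - disp p) ∂κ

/-- The collision frequency `∫ g(v_*) dκ`. -/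
def frequency (κ : Measure (Vel d × sphere (0 : Vel d) 1)) (g : Vel d → ℝ) (v : Vel d) : ℝ :=
  ∫ p, g (v - p.1) ∂κ

/-- The collision operator `∫ (g(v'_*) f(v') - g(v_*) f(v)) dκ`. -/
def collide (κ : Measure (Vel d × sphere (0 : Vel d) 1)) (g f : Vel d → ℝ) (v : Vel d) : ℝ :=
  ∫ p, (g (v - dispStar p) * f (v - disp p) - g (v - p.1) * f v) ∂κ

variable {f g : Vel d → ℝ}

lemma integrable_gain [IsFiniteMeasure κ] (hg : IsTame L g) (hf : IsTame L f) (v : Vel d) :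
    Integrable (fun p => g (v - dispStar p) * f (v - disp p)) κ := by
  obtain ⟨B, hB⟩ := hg.bdd
  obtain ⟨B', hB'⟩ := hf.bdd
  have h1 := continuous_disp (d := d)
  have h2 := continuous_dispStar (d := d)
  have h3 := hg.cont
  have h4 := hf.cont
  refine Integrable.of_bound (Continuous.aestronglyMeasurable (by fun_prop)) (B * B')
    (Filter.Eventually.of_forall fun p => ?_)
  rw [norm_mul]
  exact mul_le_mul (hB _) (hB' _) (norm_nonneg _) ((abs_nonneg _).trans (hB 0))

lemma integrable_frequency [IsFiniteMeasure κ] (hg : IsTame L g) (v : Vel d) :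
    Integrable (fun p : Vel d × sphere (0 : Vel d) 1 => g (v - p.1)) κ := by
  obtain ⟨B, hB⟩ := hg.bdd
  have h3 := hg.cont
  exact Integrable.of_bound (Continuous.aestronglyMeasurable (by fun_prop)) B
    (Filter.Eventually.of_forall fun p => hB _)

lemma isTame_integral [IsFiniteMeasure κ] {F : Vel d → Vel d × sphere (0 : Vel d) 1 → ℝ}
    (hc : Continuous (Function.uncurry F)) {B : ℝ} (hB : ∀ v p, |F v p| ≤ B)
    (hper : ∀ p, IsPeriodic L fun v => F v p) : IsTame L fun v => ∫ p, F v p ∂κ := by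
  refine ⟨continuous_of_dominated (bound := fun _ => B) ?_ ?_ (integrable_const _) ?_,
    ⟨κ.real univ * B, fun v => ?_⟩, fun i v => ?_⟩
  · exact fun v => (hc.comp (Continuous.prodMk_right v)).aestronglyMeasurable
  · exact fun v => Filter.Eventually.of_forall fun p => hB v p
  · exact Filter.Eventually.of_forall fun p => hc.comp (Continuous.prodMk_left p)
  · have := norm_integral_le_of_norm_le_const (μ := κ) (f := F v)
      (Filter.Eventually.of_forall (hB v))
    rw [mul_comm]
    exact this
  · simp only [hper _ i v]

lemma isTame_gain [IsFiniteMeasure κ] (hg : IsTame L g) (hf : IsTame L f) :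
    IsTame L (gain κ g f) := by
  obtain ⟨B, hB⟩ := hg.bdd
  obtain ⟨B', hB'⟩ := hf.bdd
  have h1 := continuous_disp (d := d)
  have h2 := continuous_dispStar (d := d)
  have h3 := hg.cont
  have h4 := hf.cont
  refine isTame_integral (B := B * B') (by unfold Function.uncurry; fun_prop) (fun v p => ?_)
    fun p i v => ?_
  · rw [abs_mul]
    exact mul_le_mul (hB _) (hB' _) (abs_nonneg _) ((abs_nonneg _).trans (hB 0))
  · simp only [add_sub_right_comm, hg.per i, hf.per i]

lemma isTame_frequency [IsFiniteMeasure κ] (hg : IsTame L g) : IsTame L (frequency κ g) := by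
  obtain ⟨B, hB⟩ := hg.bdd
  have h3 := hg.cont
  refine isTame_integral (B := B) (by unfold Function.uncurry; fun_prop) (fun v p => hB _)
    fun p i v => ?_
  simp only [add_sub_right_comm, hg.per i]

lemma collide_eq [IsFiniteMeasure κ] (hg : IsTame L g) (hf : IsTame L f) (v : Vel d) :
    collide κ g f v = gain κ g f v - frequency κ g v * f v := by
  rw [collide, integral_sub (integrable_gain hg hf v) ((integrable_frequency hg v).mul_const _),
    integral_mul_const]
  rfl

lemma isTame_collide [IsFiniteMeasure κ] (hg : IsTame L g) (hf : IsTame L f) :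
    IsTame L (collide κ g f) := by
  have h := (isTame_gain (κ := κ) hg hf).sub ((isTame_frequency (κ := κ) hg).mul hf)
  simpa only [← collide_eq hg hf] using h

lemma enorm_isPeriodic (hf : IsTame L f) : IsPeriodic L fun v => ‖f v‖ₑ := fun i v => by
  simp only [hf.per i v]

lemma BoundedLaws.normL2_gain_le (h : BoundedLaws κ R C) (hL : 0 < L) (hRL : R ≤ L)
    (hg : IsTame L g) (hf : IsTame L f) :
    normL2 L (gain κ g f) ≤ C * normL1 L g * normL2 L f := by
  have := h.isFiniteMeasure
  have hg0 := normL1_nonneg (L := L) (f := g)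
  have hf0 := normL2_nonneg (L := L) (f := f)
  refine normL2_le_of_lintegral (isTame_gain hg hf) (by positivity) ?_
  have h1 := h.lintegral_gain_sq_le hL hRL hg.cont.measurable.enorm hf.cont.measurable.enorm
    (enorm_isPeriodic hg) (enorm_isPeriodic hf)
  rw [lintegral_enorm_eq hg, lintegral_enorm_sq_eq hf] at h1
  calc ∫⁻ v, ‖gain κ g f v‖ₑ ^ 2 ∂cellMeasure d L
      ≤ ∫⁻ v, (∫⁻ p, ‖g (v - dispStar p)‖ₑ * ‖f (v - disp p)‖ₑ ∂κ) ^ 2 ∂cellMeasure d L := by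
        refine lintegral_mono fun v => ?_
        simp only
        gcongr
        refine (enorm_integral_le_lintegral_enorm _).trans_eq ?_
        simp only [enorm_mul]
    _ ≤ _ := h1
    _ = _ := by
        rw [mul_pow (C * normL1 L g : ℝ), ENNReal.ofReal_mul (by positivity),
          ENNReal.ofReal_pow (p := C * normL1 L g) (by positivity) 2,
          ENNReal.ofReal_pow hf0, ENNReal.ofReal_mul C.coe_nonneg,
          ENNReal.ofReal_coe_nnreal]

lemma BoundedLaws.abs_frequency_le (h : BoundedLaws κ R C) (hL : 0 < L) (hRL : R ≤ L)
    (hg : IsTame L g) (v : Vel d) : |frequency κ g v| ≤ C * normL1 L g := by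
  have hg0 := normL1_nonneg (L := L) (f := g)
  have h1 := h.lintegral_loss_le hL hRL hg.cont.measurable.enorm (enorm_isPeriodic hg) v
  rw [lintegral_enorm_eq hg] at h1
  rw [← ENNReal.ofReal_le_ofReal_iff (by positivity), ← Real.enorm_eq_ofReal_abs,
    ENNReal.ofReal_mul (by positivity), ENNReal.ofReal_coe_nnreal]
  exact (enorm_integral_le_lintegral_enorm _).trans h1

lemma normL2_mul_le {B : ℝ} (hB0 : 0 ≤ B) (hB : ∀ v, |g v| ≤ B) (hg : IsTame L g)
    (hf : IsTame L f) : normL2 L (fun v => g v * f v) ≤ B * normL2 L f := by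
  refine normL2_le_of_lintegral (hg.mul hf) (mul_nonneg hB0 normL2_nonneg) ?_
  rw [mul_pow, ENNReal.ofReal_mul (sq_nonneg _), ← lintegral_enorm_sq_eq hf,
    ← lintegral_const_mul _ (hf.cont.measurable.enorm.pow_const 2)]
  refine lintegral_mono fun v => ?_
  simp only [enorm_mul, mul_pow, ENNReal.ofReal_pow hB0]
  gcongr
  rw [Real.enorm_eq_ofReal_abs]
  exact ENNReal.ofReal_le_ofReal (hB v)

/-- The bilinear estimate on which all three bounds rest: the collision operator is continuous
from `L¹ × L²` to `L²`. -/
theorem BoundedLaws.normL2_collide_le (h : BoundedLaws κ R C) (hL : 0 < L) (hRL : R ≤ L)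
    (hg : IsTame L g) (hf : IsTame L f) :
    normL2 L (collide κ g f) ≤ 2 * C * normL1 L g * normL2 L f := by
  have := h.isFiniteMeasure
  have hg0 := normL1_nonneg (L := L) (f := g)
  have h1 := h.normL2_gain_le hL hRL hg hf
  have hfr := (isTame_frequency (κ := κ) hg).neg
  have h2 := normL2_mul_le (B := C * normL1 L g) (by positivity)
    (fun v => by simpa using h.abs_frequency_le hL hRL hg v) hfr hf
  have h3 := normL2_add_le (isTame_gain (κ := κ) hg hf) fun v => -frequency κ g v * f v
  have h4 : collide κ g f = fun v => gain κ g f v + -frequency κ g v * f v := by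
    funext v
    rw [collide_eq hg hf]
    ring
  rw [h4]
  linarith

/-- The gain term of `(f, f)` can be negative only through a factor `f⁻`, since
`x y ≥ -(|x| y⁻ + x⁻ |y|)`. -/
lemma neg_gain_le_gain [IsFiniteMeasure κ] (hf : IsTame L f) (v : Vel d) :
    -(gain κ (fun v => |f v|) (negativePart f) v + gain κ (negativePart f) (fun v => |f v|) v) ≤
      gain κ f f v := by
  have hn := hf.negativePart
  have key : ∀ x y : ℝ, -(|x| * max (-y) 0 + max (-x) 0 * |y|) ≤ x * y := by
    intro x y
    rcases le_total x 0 with hx | hx <;> rcases le_total y 0 with hy | hy <;>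
      simp only [abs_of_nonneg, abs_of_nonpos, hx, hy, max_eq_left, max_eq_right, neg_nonneg,
        neg_nonpos] <;> nlinarith
  unfold gain
  rw [← integral_add (integrable_gain hf.abs hn v) (integrable_gain hn hf.abs v), ← integral_neg]
  refine integral_mono ((integrable_gain hf.abs hn v).add (integrable_gain hn hf.abs v)).neg
    (integrable_gain hf hf v) fun p => key _ _

/-- The collision operator decreases the negative part up to a linear rate: in `Q(f, f)` the only
negative contributions of the gain term contain a factor `f⁻`, and so does `f⁻` times the loss. -/
theorem BoundedLaws.neg_integral_negativePart_mul_collide_le (h : BoundedLaws κ R C) (hL : 0 < L)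
    (hRL : R ≤ L) (hf : IsTame L f) :
    -∫ v, negativePart f v * collide κ f f v ∂cellMeasure d L ≤
      C * (2 * normL1 L f + Real.sqrt ((2 * L) ^ d) * normL2 L f) *
        normL2 L (negativePart f) ^ 2 := by
  have := h.isFiniteMeasure
  have hn := hf.negativePart
  set n := negativePart f with hndef
  have hA := isTame_gain (κ := κ) hf.abs hn
  have hB := isTame_gain (κ := κ) hn hf.abs
  have hA1 := (le_abs_self _).trans (abs_integral_mul_le hn hA)
  have hB1 := (le_abs_self _).trans (abs_integral_mul_le hn hB)
  have hA2 := h.normL2_gain_le hL hRL hf.abs hn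
  have hB2 := h.normL2_gain_le hL hRL hn hf.abs
  have e1 : normL1 L (fun v => |f v|) = normL1 L f := lpNorm_fun_abs hf.cont.aestronglyMeasurable 1
  have e2 : normL2 L (fun v => |f v|) = normL2 L f := lpNorm_fun_abs hf.cont.aestronglyMeasurable 2
  rw [e1] at hA2
  rw [e2] at hB2
  have hn1 := normL1_le hL hn
  have hn0 := normL2_nonneg (L := L) (f := n)
  have hf0 := normL2_nonneg (L := L) (f := f)
  have hfr := isTame_frequency (κ := κ) hf
  have hpt : ∀ v, -(n v * collide κ f f v) ≤
      n v * gain κ (fun v => |f v|) n v + n v * gain κ n (fun v => |f v|) v +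
        C * normL1 L f * n v ^ 2 := by
    intro v
    have hnv : 0 ≤ n v := le_max_right _ _
    have hfn : n v * f v = -n v ^ 2 := by
      rw [hndef, negativePart]
      rcases le_total (f v) 0 with hx | hx <;> simp [hx, sq]
    have h1 := neg_gain_le_gain (κ := κ) hf v
    have h2 := (abs_le.1 (h.abs_frequency_le hL hRL hf v)).1
    rw [collide_eq hf hf]
    have h3 := mul_le_mul_of_nonneg_left h1 hnv
    have h4 := mul_le_mul_of_nonneg_right h2 (sq_nonneg (n v))
    have h5 : n v * (gain κ f f v - frequency κ f v * f v) =
        n v * gain κ f f v + frequency κ f v * n v ^ 2 := by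
      linear_combination -frequency κ f v * hfn
    rw [h5]
    linarith
  have hint := integral_mono (μ := cellMeasure d L) (hn.mul (isTame_collide hf hf)).neg.integrable
    (((hn.mul hA).add (hn.mul hB)).add
      ((isTame_const (C * normL1 L f)).mul (hn.mul hn))).integrable
    (fun v => by simpa only [sq] using hpt v)
  rw [integral_neg, integral_add ((hn.mul hA).add (hn.mul hB)).integrable
      ((isTame_const (C * normL1 L f)).mul (hn.mul hn)).integrable,
    integral_add (hn.mul hA).integrable (hn.mul hB).integrable, integral_const_mul] at hint
  have hsq := normL2_sq hn
  simp only [sq] at hsq ⊢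
  rw [← hsq] at hint
  have h6 := mul_le_mul_of_nonneg_left hA2 hn0
  have h7 := mul_le_mul_of_nonneg_left (hB2.trans (mul_le_mul_of_nonneg_right
    (mul_le_mul_of_nonneg_left hn1 C.coe_nonneg) hf0)) hn0
  linarith

end Operators

/-! ### Trigonometric polynomials -/

section Modes

variable {d : ℕ} {L : ℝ}

lemma fourierMode_add_index (k l : Fin d → ℤ) (v : Vel d) :
    fourierMode L (k + l) v = fourierMode L k v * fourierMode L l v := by
  simp only [fourierMode, ← Complex.exp_add, ← mul_add, ← Complex.ofReal_add,
    ← Finset.sum_add_distrib, Pi.add_apply, Int.cast_add, add_mul]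

lemma fourierMode_add (k : Fin d → ℤ) (v w : Vel d) :
    fourierMode L k (v + w) = fourierMode L k v * fourierMode L k w := by
  simp only [fourierMode, ← Complex.exp_add, ← mul_add, ← Complex.ofReal_add,
    ← Finset.sum_add_distrib, PiLp.add_apply]

lemma fourierMode_sub (k : Fin d → ℤ) (v w : Vel d) :
    fourierMode L k (v - w) = fourierMode L k v * fourierMode L k (-w) := by
  rw [sub_eq_add_neg, fourierMode_add]

lemma conj_fourierMode (k : Fin d → ℤ) (v : Vel d) :
    conj (fourierMode L k v) = fourierMode L (-k) v := by
  simp only [fourierMode, ← Complex.exp_conj, map_mul, Complex.conj_I, Complex.conj_ofReal]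
  congr 1
  simp

lemma norm_fourierMode (k : Fin d → ℤ) (v : Vel d) : ‖fourierMode L k v‖ = 1 := by
  rw [fourierMode, mul_comm, Complex.norm_exp_ofReal_mul_I]

lemma continuous_fourierMode (k : Fin d → ℤ) : Continuous (fourierMode L k) := by
  unfold fourierMode
  fun_prop

lemma fourierMode_single (k : Fin d → ℤ) (i : Fin d) (r : ℝ) :
    fourierMode L k (EuclideanSpace.single i r) =
      Complex.exp (Complex.I * ((Real.pi / L * (k i * r) : ℝ) : ℂ)) := by
  rw [fourierMode]
  congr 4
  rw [Finset.sum_eq_single i] <;> simp +contextual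

lemma fourierMode_isPeriodic (hL : 0 < L) (k : Fin d → ℤ) : IsPeriodic L (fourierMode L k) := by
  intro i v
  rw [fourierMode_add, fourierMode_single]
  have : Complex.I * ((Real.pi / L * (k i * (2 * L)) : ℝ) : ℂ) =
      (k i : ℂ) * (2 * Real.pi * Complex.I) := by
    have hL' : (L : ℂ) ≠ 0 := by exact_mod_cast hL.ne'
    push_cast
    field_simp
  rw [this, Complex.exp_int_mul_two_pi_mul_I, mul_one]

/-- A nonconstant mode has mean zero, since some translation changes its sign. -/
lemma integral_fourierMode (hL : 0 < L) {k : Fin d → ℤ} (hk : k ≠ 0) :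
    ∫ v, fourierMode L k v ∂cellMeasure d L = 0 := by
  obtain ⟨i, hi⟩ := Function.ne_iff.1 hk
  have hi' : (k i : ℝ) ≠ 0 := by exact_mod_cast hi
  have h := integral_cell_add hL (fourierMode_isPeriodic hL k) (EuclideanSpace.single i (L / k i))
  have hw : fourierMode L k (EuclideanSpace.single i (L / k i)) = -1 := by
    rw [fourierMode_single]
    have : Real.pi / L * (k i * (L / k i)) = Real.pi := by field_simp
    rw [this, mul_comm, Complex.exp_pi_mul_I]
  simp only [fourierMode_add, hw, mul_neg, mul_one, integral_neg] at h
  exact self_eq_neg.1 h.symm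

lemma integral_fourierMode_mul_conj (hL : 0 < L) (k l : Fin d → ℤ) :
    ∫ v, fourierMode L k v * conj (fourierMode L l v) ∂cellMeasure d L =
      if k = l then ((2 * L : ℝ) : ℂ) ^ d else 0 := by
  simp only [conj_fourierMode, ← fourierMode_add_index]
  split_ifs with h
  · subst h
    have : ∀ v : Vel d, fourierMode L (k + -k) v = 1 := fun v => by simp [fourierMode]
    simp only [this]
    simp [cellMeasure, Measure.real, volume_cell hL, hL.le]
  · exact integral_fourierMode hL (by rwa [← sub_eq_add_neg, sub_ne_zero])

end Modes

/-- Finitely supported Fourier coefficients. -/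
abbrev Coef (d : ℕ) : Type := (Fin d → ℤ) →₀ ℂ

/-- The trigonometric polynomial with the given coefficients. -/
def trig {d : ℕ} (L : ℝ) (c : Coef d) : Vel d → ℂ :=
  Finsupp.linearCombination ℂ (fourierMode L) c

/-- The real-valued function `f` is the trigonometric polynomial with coefficients `c`. -/
def HasCoef {d : ℕ} (L : ℝ) (f : Vel d → ℝ) (c : Coef d) : Prop :=
  ∀ v, (f v : ℂ) = trig L c v

/-- The sum of the squared moduli of the coefficients. -/
def energy {d : ℕ} (c : Coef d) : ℝ := ∑ k ∈ c.support, ‖c k‖ ^ 2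

section Coefficients

variable {d : ℕ} {L : ℝ} {f g : Vel d → ℝ} {a c : Coef d}

lemma trig_apply (c : Coef d) (v : Vel d) :
    trig L c v = ∑ k ∈ c.support, c k * fourierMode L k v := by
  simp [trig, Finsupp.linearCombination_apply, Finsupp.sum, Finset.sum_apply]

lemma HasCoef.isTame (hL : 0 < L) (h : HasCoef L f c) : IsTame L f := by
  have hre : f = fun v => (trig L c v).re := by
    funext v
    rw [← h v, Complex.ofReal_re]
  have hper : IsPeriodic L (trig L c) := fun i v => by
    simp only [trig_apply, fourierMode_isPeriodic hL _ i v]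
  refine ⟨?_, ⟨∑ k ∈ c.support, ‖c k‖, fun v => ?_⟩, fun i v => ?_⟩
  · rw [hre]
    have := fun k => continuous_fourierMode (L := L) (d := d) k
    simp only [trig_apply]
    fun_prop
  · rw [← Real.norm_eq_abs, ← Complex.norm_real, h v, trig_apply]
    refine (norm_sum_le _ _).trans (Finset.sum_le_sum fun k _ => ?_)
    rw [norm_mul, norm_fourierMode, mul_one]
  · rw [hre]
    simp only [hper i v]

lemma integrable_of_continuous_of_bound {F : Vel d → ℂ} (hF : Continuous F) {B : ℝ}
    (hB : ∀ v, ‖F v‖ ≤ B) : Integrable F (cellMeasure d L) :=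
  Integrable.of_bound hF.aestronglyMeasurable B (Filter.Eventually.of_forall hB)

lemma integral_trig_mul_conj (hL : 0 < L) (c : Coef d) (k : Fin d → ℤ) :
    ∫ v, trig L c v * conj (fourierMode L k v) ∂cellMeasure d L = ((2 * L : ℝ) : ℂ) ^ d * c k := by
  simp only [trig_apply, Finset.sum_mul, mul_assoc]
  rw [integral_finsetSum]
  · simp only [integral_const_mul, integral_fourierMode_mul_conj hL, mul_ite, mul_zero,
      Finset.sum_ite_eq']
    split_ifs with h
    · ring
    · rw [Finsupp.notMem_support_iff.1 h, mul_zero]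
  · intro l _
    refine (integrable_of_continuous_of_bound (B := 1) ?_ fun v => ?_).const_mul _
    · exact (continuous_fourierMode l).mul (Complex.continuous_conj.comp (continuous_fourierMode k))
    · rw [norm_mul, RCLike.norm_conj, norm_fourierMode, norm_fourierMode, one_mul]

lemma HasCoef.fourierCoefficient_eq (hL : 0 < L) (h : HasCoef L f c) (k : Fin d → ℤ) :
    fourierCoefficient L f k = c k := by
  simp only [fourierCoefficient, h _, integral_trig_mul_conj hL]
  have : ((2 * L : ℝ) : ℂ) ^ d ≠ 0 := pow_ne_zero _ (by exact_mod_cast (by positivity))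
  field_simp

/-- Parseval's identity. -/
lemma HasCoef.normL2_sq (hL : 0 < L) (h : HasCoef L f c) :
    normL2 L f ^ 2 = (2 * L) ^ d * energy c := by
  rw [FourierBoltzmann.normL2_sq (h.isTame hL), ← Complex.ofReal_inj, ← integral_complex_ofReal]
  have h1 : ∀ v, ((f v ^ 2 : ℝ) : ℂ) =
      ∑ k ∈ c.support, conj (c k) * (trig L c v * conj (fourierMode L k v)) := by
    intro v
    have h2 : ((f v ^ 2 : ℝ) : ℂ) = trig L c v * conj (trig L c v) := by
      rw [← h v, Complex.conj_ofReal]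
      push_cast
      ring
    rw [h2]
    nth_rw 2 [trig_apply]
    rw [map_sum, Finset.mul_sum]
    refine Finset.sum_congr rfl fun k _ => ?_
    rw [map_mul]
    ring
  simp only [h1]
  rw [integral_finsetSum]
  · simp only [integral_const_mul, integral_trig_mul_conj hL, energy]
    push_cast
    rw [Finset.mul_sum]
    refine Finset.sum_congr rfl fun k _ => ?_
    rw [← Complex.conj_mul']
    ring
  · intro k _
    have hc : Continuous (trig L c) := by
      have : trig L c = fun v => (f v : ℂ) := funext fun v => (h v).symm
      rw [this]
      exact Complex.continuous_ofReal.comp (h.isTame hL).cont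
    obtain ⟨B, hB⟩ := (h.isTame hL).bdd
    refine (integrable_of_continuous_of_bound (B := B) ?_ fun v => ?_).const_mul _
    · exact hc.mul (Complex.continuous_conj.comp (continuous_fourierMode k))
    · rw [norm_mul, RCLike.norm_conj, norm_fourierMode, mul_one, ← h v, Complex.norm_real]
      exact hB v

lemma HasCoef.add (hf : HasCoef L f c) (hg : HasCoef L g a) :
    HasCoef L (fun v => f v + g v) (c + a) := fun v => by
  simp only [Complex.ofReal_add, hf v, hg v, trig, map_add, Pi.add_apply]

lemma HasCoef.sub (hf : HasCoef L f c) (hg : HasCoef L g a) :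
    HasCoef L (fun v => f v - g v) (c - a) := fun v => by
  simp only [Complex.ofReal_sub, hf v, hg v, trig, map_sub, Pi.sub_apply]

/-- The action of `∂_i` on Fourier coefficients. -/
def diffCoef (L : ℝ) (i : Fin d) : Coef d →ₗ[ℂ] Coef d where
  toFun c := Finsupp.onFinset c.support (fun k => Complex.I * (Real.pi / L * k i : ℝ) * c k)
    fun k hk => Finsupp.mem_support_iff.2 (right_ne_zero_of_mul hk)
  map_add' a c := by
    ext k
    simp [mul_add]
  map_smul' r c := by
    ext k
    simp
    ring

lemma diffCoef_apply (i : Fin d) (c : Coef d) (k : Fin d → ℤ) :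
    diffCoef L i c k = Complex.I * (Real.pi / L * k i : ℝ) * c k := rfl

lemma diffCoef_single (i : Fin d) (k : Fin d → ℤ) (x : ℂ) :
    diffCoef L i (Finsupp.single k x) =
      Finsupp.single k (Complex.I * (Real.pi / L * k i : ℝ) * x) := by
  ext l
  rw [diffCoef_apply]
  by_cases h : k = l
  · subst h; simp
  · simp [Finsupp.single_eq_of_ne' h]

lemma sum_diffCoef {α : Type*} [AddCommMonoid α] (i : Fin d) (c : Coef d)
    (h : (Fin d → ℤ) → ℂ → α) (h0 : ∀ k, h k 0 = 0) :
    (diffCoef L i c).sum h = c.sum fun k x => h k (Complex.I * (Real.pi / L * k i : ℝ) * x) :=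
  Finsupp.onFinset_sum
    (fun _ hk => Finsupp.mem_support_iff.2 (right_ne_zero_of_mul hk)) h0

lemma HasCoef.partialDeriv (h : HasCoef L f c) (i : Fin d) :
    HasCoef L (partialDeriv i f) (diffCoef L i c) := by
  intro v
  have hre : f = fun v => (trig L c v).re := by
    funext v
    rw [← h v, Complex.ofReal_re]
  have hdiff : Differentiable ℝ f := by
    rw [hre]
    simp only [trig_apply]
    unfold fourierMode
    fun_prop
  have h1 : HasDerivAt (fun t : ℝ => f (v + t • EuclideanSpace.single i 1))
      (FourierBoltzmann.partialDeriv i f v) 0 := by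
    have := (hdiff v).hasFDerivAt.hasLineDerivAt (EuclideanSpace.single i (1 : ℝ))
    exact this
  have h2 := h1.ofReal_comp
  have h3 : HasDerivAt (fun t : ℝ => ((f (v + t • EuclideanSpace.single i 1) : ℝ) : ℂ))
      (trig L (diffCoef L i c) v) 0 := by
    have h4 : ∀ t : ℝ, ((f (v + t • EuclideanSpace.single i 1) : ℝ) : ℂ) =
        ∑ k ∈ c.support, c k * (fourierMode L k v *
          Complex.exp (Complex.I * (Real.pi / L * k i : ℝ) * t)) := by
      intro t
      rw [h, trig_apply]
      refine Finset.sum_congr rfl fun k _ => ?_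
      rw [fourierMode_add]
      have : t • (EuclideanSpace.single i 1 : Vel d) = EuclideanSpace.single i t := by
        ext j; simp
      rw [this, fourierMode_single]
      push_cast
      ring_nf
    simp only [h4]
    have h5 : trig L (diffCoef L i c) v = ∑ k ∈ c.support, c k * (fourierMode L k v *
        (Complex.exp (Complex.I * (Real.pi / L * k i : ℝ) * (0 : ℝ)) *
          (Complex.I * (Real.pi / L * k i : ℝ) * 1))) := by
      have := sum_diffCoef (L := L) i c (fun k x => x * fourierMode L k v) (by simp)
      rw [trig_apply]
      refine this.trans (Finset.sum_congr rfl fun k _ => ?_)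
      simp
      ring
    rw [h5]
    refine HasDerivAt.fun_sum fun k _ => ?_
    refine (HasDerivAt.const_mul _ ?_).const_mul _
    exact ((Complex.ofRealCLM.hasDerivAt (x := (0 : ℝ))).const_mul _).cexp
  exact h2.unique h3

lemma energy_eq_sum {s : Finset (Fin d → ℤ)} (hs : c.support ⊆ s) :
    energy c = ∑ k ∈ s, ‖c k‖ ^ 2 := by
  refine Finset.sum_subset hs fun k _ hk => ?_
  rw [Finsupp.notMem_support_iff.1 hk]
  simp

lemma energy_mono (h : ∀ k, ‖a k‖ ≤ ‖c k‖) : energy a ≤ energy c := by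
  have hs : a.support ⊆ c.support := fun k hk => by
    rw [Finsupp.mem_support_iff] at hk ⊢
    exact norm_pos_iff.1 ((norm_pos_iff.2 hk).trans_le (h k))
  rw [energy_eq_sum hs]
  exact Finset.sum_le_sum fun k _ => pow_le_pow_left₀ (norm_nonneg _) (h k) 2

lemma HasCoef.normL2_le (hL : 0 < L) (hf : HasCoef L f c) (hg : HasCoef L g a)
    (h : energy c ≤ energy a) : normL2 L f ≤ normL2 L g := by
  refine (sq_le_sq₀ normL2_nonneg normL2_nonneg).1 ?_
  rw [hf.normL2_sq hL, hg.normL2_sq hL]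
  gcongr

/-- Truncation of the coefficients to the modes of `ℙ_N`. -/
def truncate (N : ℕ) (c : Coef d) : Coef d := c.filter (· ∈ modes d N)

lemma truncate_apply (N : ℕ) (c : Coef d) (k : Fin d → ℤ) :
    truncate N c k = if k ∈ modes d N then c k else 0 := by
  simp [truncate, Finsupp.filter_apply]

lemma norm_truncate_le (N : ℕ) (c : Coef d) (k : Fin d → ℤ) : ‖truncate N c k‖ ≤ ‖c k‖ := by
  rw [truncate_apply]
  split_ifs <;> simp

lemma diffCoef_truncate (N : ℕ) (i : Fin d) (c : Coef d) :
    diffCoef L i (truncate N c) = truncate N (diffCoef L i c) := by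
  ext k
  simp only [diffCoef_apply, truncate_apply]
  split_ifs <;> simp

lemma HasCoef.fourierProj_eq (hL : 0 < L) (h : HasCoef L f c) (N : ℕ) (v : Vel d) :
    fourierProj L N f v = trig L (truncate N c) v := by
  have hs : (truncate N c).support ⊆ modes d N := fun k hk => by
    rw [Finsupp.mem_support_iff, truncate_apply] at hk
    by_contra hn
    simp [hn] at hk
  rw [fourierProj, trig_apply, Finset.sum_subset hs]
  · refine Finset.sum_congr rfl fun k hk => ?_
    rw [h.fourierCoefficient_eq hL, truncate_apply, if_pos hk]
  · intro k _ hk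
    rw [Finsupp.notMem_support_iff.1 hk, zero_mul]

lemma IsRealTrig.exists_coef {N : ℕ} (h : IsRealTrig L N f) :
    ∃ c : Coef d, HasCoef L f c ∧ truncate N c = c := by
  obtain ⟨c, hc, hcf⟩ := (Finsupp.mem_span_image_iff_linearCombination ℂ).1 h
  refine ⟨c, fun v => (congrFun hcf v).symm, ?_⟩
  ext k
  rw [truncate_apply]
  split_ifs with hk
  · rfl
  · have : k ∉ c.support := fun hs => hk ((Finsupp.mem_supported ℂ c).1 hc hs)
    exact (Finsupp.notMem_support_iff.1 this).symm

/-- A mode outside `ℙ_N` has a frequency exceeding `N / 2`, so that the tail is controlled by the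
gradient. -/
lemma energy_sub_truncate_le (hL : 0 < L) {N : ℕ} (hN : 1 ≤ N) (c : Coef d) :
    energy (c - truncate N c) ≤ (2 * L / (Real.pi * N)) ^ 2 * ∑ i, energy (diffCoef L i c) := by
  have hs : (c - truncate N c).support ⊆ c.support := fun k hk => by
    rw [Finsupp.mem_support_iff] at hk ⊢
    rintro h
    simp [truncate_apply, h] at hk
  have hsi : ∀ i, (diffCoef L i c).support ⊆ c.support := fun i k hk => by
    rw [Finsupp.mem_support_iff] at hk ⊢
    exact right_ne_zero_of_mul hk
  have hNpos : (0 : ℝ) < N := by exact_mod_cast hN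
  rw [energy_eq_sum hs, Finset.sum_congr rfl fun i _ => energy_eq_sum (hsi i), Finset.sum_comm,
    Finset.mul_sum]
  refine Finset.sum_le_sum fun k _ => ?_
  have hnn : ∀ i ∈ Finset.univ, 0 ≤ ‖diffCoef L i c k‖ ^ 2 := fun i _ => sq_nonneg _
  rw [Finsupp.sub_apply, truncate_apply]
  split_ifs with hk
  · rw [sub_self, norm_zero]
    rw [zero_pow two_ne_zero]
    exact mul_nonneg (sq_nonneg _) (Finset.sum_nonneg hnn)
  · obtain ⟨i, hi⟩ : ∃ i, ¬(k i ∈ Finset.Icc (-((N : ℤ) / 2)) ((N : ℤ) / 2)) := by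
      simpa [modes, Fintype.mem_piFinset] using hk
    have hki : (N : ℝ) / 2 ≤ |(k i : ℝ)| := by
      have h1 : (N : ℤ) ≤ 2 * |k i| := by
        rw [Finset.mem_Icc, ← abs_le] at hi
        omega
      have h2 : (N : ℝ) ≤ 2 * |(k i : ℝ)| := by exact_mod_cast h1
      linarith
    -- The single coordinate `i` of the frequency already accounts for the factor `N / 2`.
    have hterm : ‖c k‖ ^ 2 ≤ (2 * L / (Real.pi * N)) ^ 2 * ‖diffCoef L i c k‖ ^ 2 := by
      have hpi := Real.pi_pos
      rw [← mul_pow, diffCoef_apply, norm_mul, norm_mul, Complex.norm_I, Complex.norm_real,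
        Real.norm_eq_abs, abs_mul, abs_of_pos (by positivity : 0 < Real.pi / L)]
      refine pow_le_pow_left₀ (norm_nonneg _) ?_ 2
      calc ‖c k‖ = 2 / N * (N / 2) * ‖c k‖ := by field_simp
        _ ≤ 2 / N * |(k i : ℝ)| * ‖c k‖ := by gcongr
        _ = _ := by field_simp
    rw [sub_zero]
    refine hterm.trans ?_
    gcongr
    exact Finset.single_le_sum (f := fun i => ‖diffCoef L i c k‖ ^ 2) hnn (Finset.mem_univ i)

end Coefficients

section Collision

variable {d : ℕ} {L : ℝ} {f g : Vel d → ℝ} {a c : Coef d}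
  {κ : Measure (Vel d × sphere (0 : Vel d) 1)}

/-- The kernel mode `∫ (e_k(v'_* - v) e_l(v' - v) - e_k(v_* - v)) dκ`. -/
def kernelMode (κ : Measure (Vel d × sphere (0 : Vel d) 1)) (L : ℝ) (k l : Fin d → ℤ) : ℂ :=
  ∫ p, (fourierMode L k (-dispStar p) * fourierMode L l (-disp p) - fourierMode L k (-p.1)) ∂κ

/-- The Fourier coefficients of the collision of two trigonometric polynomials. -/
def collideCoef (κ : Measure (Vel d × sphere (0 : Vel d) 1)) (L : ℝ) (a c : Coef d) : Coef d :=
  a.sum fun k x => c.sum fun l y => Finsupp.single (k + l) (x * y * kernelMode κ L k l)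

lemma HasCoef.collide [IsFiniteMeasure κ] (hg : HasCoef L g a) (hf : HasCoef L f c) :
    HasCoef L (collide κ g f) (collideCoef κ L a c) := by
  intro v
  have hint : ∀ k l, Integrable (fun p => fourierMode L k (-dispStar p) *
      fourierMode L l (-disp p) - fourierMode L k (-p.1)) κ := by
    intro k l
    have h1 := continuous_disp (d := d)
    have h2 := continuous_dispStar (d := d)
    have h3 := continuous_fourierMode (L := L) k
    have h4 := continuous_fourierMode (L := L) l
    refine Integrable.of_bound (Continuous.aestronglyMeasurable (by fun_prop)) 2
      (Filter.Eventually.of_forall fun p => (norm_sub_le _ _).trans ?_)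
    rw [norm_mul, norm_fourierMode, norm_fourierMode, norm_fourierMode]
    norm_num
  have h1 : ∀ p : Vel d × sphere (0 : Vel d) 1,
      ((g (v - dispStar p) * f (v - disp p) - g (v - p.1) * f v : ℝ) : ℂ) =
      ∑ k ∈ a.support, ∑ l ∈ c.support, a k * c l * fourierMode L (k + l) v *
        (fourierMode L k (-dispStar p) * fourierMode L l (-disp p) - fourierMode L k (-p.1)) := by
    intro p
    push_cast
    simp only [hg _, hf _, trig_apply, Finset.sum_mul_sum, ← Finset.sum_sub_distrib]
    refine Finset.sum_congr rfl fun k _ => Finset.sum_congr rfl fun l _ => ?_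
    rw [fourierMode_sub, fourierMode_sub, fourierMode_sub, fourierMode_add_index]
    ring
  rw [FourierBoltzmann.collide, ← integral_complex_ofReal]
  simp only [h1]
  rw [integral_finsetSum _ fun k _ => integrable_finsetSum _ fun l _ => (hint k l).const_mul _]
  simp only [trig, collideCoef, Finsupp.sum, map_sum, Finset.sum_apply]
  refine Finset.sum_congr rfl fun k _ => ?_
  rw [integral_finsetSum _ fun l _ => (hint k l).const_mul _]
  refine Finset.sum_congr rfl fun l _ => ?_
  rw [integral_const_mul, Finsupp.linearCombination_single, Pi.smul_apply, smul_eq_mul, kernelMode]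
  ring

/-- Leibniz' rule, which expresses the translation invariance of the collision operator. -/
lemma diffCoef_collideCoef (i : Fin d) (a c : Coef d) :
    diffCoef L i (collideCoef κ L a c) =
      collideCoef κ L (diffCoef L i a) c + collideCoef κ L a (diffCoef L i c) := by
  unfold collideCoef
  rw [sum_diffCoef i a _ (by simp)]
  have hc : ∀ k x, ((diffCoef L i c).sum fun l y =>
      Finsupp.single (k + l) (x * y * kernelMode κ L k l)) = c.sum fun l y => Finsupp.single (k + l)
        (x * (Complex.I * (Real.pi / L * l i : ℝ) * y) * kernelMode κ L k l) :=
    fun k x => sum_diffCoef i c _ (by simp)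
  simp only [hc]
  simp only [Finsupp.sum, map_sum, diffCoef_single, ← Finset.sum_add_distrib, ← Finsupp.single_add]
  refine Finset.sum_congr rfl fun k _ => Finset.sum_congr rfl fun l _ => ?_
  congr 1
  simp only [Pi.add_apply]
  push_cast
  ring

end Collision

/-! ### Evolution of the Fourier coefficients -/

open Filter Asymptotics

/-- A separating family of functionals on a finite-dimensional space spans its dual. -/
lemma exists_finsupp_of_separating {K V X : Type*} [Field K] [AddCommGroup V] [Module K V]
    [FiniteDimensional K V] (ev : X → Module.Dual K V)
    (h : ∀ x, (∀ v, ev v x = 0) → x = 0) (T : Module.Dual K V) :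
    ∃ w : X →₀ K, ∀ x, T x = ∑ v ∈ w.support, w v * ev v x := by
  have hco : (Submodule.span K (range ev)).dualCoannihilator = ⊥ := by
    rw [eq_bot_iff]
    intro x hx
    rw [Submodule.mem_dualCoannihilator] at hx
    exact h x fun v => hx _ (Submodule.subset_span ⟨v, rfl⟩)
  have hT : T ∈ Submodule.span K (range ev) := by
    rw [← Subspace.dualCoannihilator_dualAnnihilator_eq (W := Submodule.span K (range ev)), hco,
      Submodule.dualAnnihilator_bot]
    trivial
  obtain ⟨w, hw⟩ := (Finsupp.mem_span_range_iff_exists_finsupp).1 hT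
  refine ⟨w, fun x => ?_⟩
  rw [← hw]
  simp [Finsupp.sum]

section Flow

variable {d : ℕ} {L : ℝ} {N : ℕ}

/-- On the finite-dimensional space `ℙ_N` a Fourier coefficient is a combination of finitely many
point values, because the point evaluations separate points and hence span the dual space. -/
lemma exists_eval_combination (hL : 0 < L) (N : ℕ) (k : Fin d → ℤ) :
    ∃ w : Vel d →₀ ℂ, ∀ c : Coef d, truncate N c = c →
      c k = ∑ v ∈ w.support, w v * trig L c v := by
  set V : Submodule ℂ (Coef d) := Finsupp.supported ℂ ℂ (modes d N : Set (Fin d → ℤ)) with hV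
  have : FiniteDimensional ℂ V := by
    have e := Finsupp.supportedEquivFinsupp (M := ℂ) (R := ℂ) (modes d N : Set (Fin d → ℤ))
    exact Module.Finite.equiv e.symm
  obtain ⟨w, hw⟩ := exists_finsupp_of_separating (K := ℂ) (V := V)
    (fun v => (LinearMap.proj v ∘ₗ Finsupp.linearCombination ℂ (fourierMode L)) ∘ₗ V.subtype)
    (fun c hc => by
      have h0 : HasCoef L (fun _ : Vel d => 0) c.1 := fun v =>
        Complex.ofReal_zero.trans (hc v).symm
      have h00 : HasCoef L (fun _ : Vel d => 0) (0 : Coef d) := fun v => by simp [trig]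
      ext l
      rw [← h0.fourierCoefficient_eq hL, h00.fourierCoefficient_eq hL]
      rfl)
    ((Finsupp.lapply k : Coef d →ₗ[ℂ] ℂ) ∘ₗ V.subtype)
  refine ⟨w, fun c hc => ?_⟩
  have hcV : c ∈ V := by
    rw [hV, Finsupp.mem_supported]
    intro l hl
    by_contra hn
    rw [Finset.mem_coe] at hl hn
    rw [Finsupp.mem_support_iff, ← hc, truncate_apply, if_neg hn] at hl
    exact hl rfl
  exact hw ⟨c, hcV⟩

/-- The Galerkin system for the Fourier coefficients `c` of `f`. The last field records that the
right-hand side is real-valued. -/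
structure IsCoefFlow (κ : Measure (Vel d × sphere (0 : Vel d) 1)) (L : ℝ) (N : ℕ) (t₀ : ℝ)
    (f : ℝ → Vel d → ℝ) (c : ℝ → Coef d) : Prop where
  hasCoef : ∀ t ∈ Icc 0 t₀, HasCoef L (f t) (c t)
  trunc : ∀ t ∈ Icc 0 t₀, truncate N (c t) = c t
  cont : ∀ k, ContinuousOn (fun t => c t k) (Icc 0 t₀)
  deriv : ∀ t ∈ Ioo 0 t₀, ∀ k,
    HasDerivAt (fun s => c s k) (truncate N (collideCoef κ L (c t) (c t)) k) t
  real : ∀ t ∈ Ioo 0 t₀, ∃ h, HasCoef L h (truncate N (collideCoef κ L (c t) (c t)))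

lemma truncate_truncate (N : ℕ) (c : Coef d) : truncate N (truncate N c) = truncate N c := by
  ext k
  simp only [truncate_apply]
  split_ifs <;> rfl

/-- A pointwise solution of the Galerkin system solves it in the Fourier coefficients, which are
fixed combinations of finitely many point values. -/
lemma exists_isCoefFlow (hL : 0 < L) {κ : Measure (Vel d × sphere (0 : Vel d) 1)}
    [IsFiniteMeasure κ] {Φ b : ℝ → ℝ} {R t₀ : ℝ} {f₀ : Vel d → ℝ} {f : ℝ → Vel d → ℝ}
    (hf : IsGalerkinSolution Φ b R L N t₀ f₀ f)
    (hκ : ∀ g : Vel d → ℝ, IsTame L g → collision Φ b R g g = collide κ g g) :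
    ∃ c, IsCoefFlow κ L N t₀ f c := by
  have hex : ∀ t, ∃ c : Coef d, t ∈ Icc 0 t₀ → HasCoef L (f t) c ∧ truncate N c = c := by
    intro t
    by_cases ht : t ∈ Icc 0 t₀
    · obtain ⟨c, hc⟩ := (hf.mem t ht).exists_coef
      exact ⟨c, fun _ => hc⟩
    · exact ⟨0, fun h => absurd h ht⟩
  choose c hc using hex
  have heqn : ∀ t ∈ Ioo 0 t₀, ∀ v, HasDerivAt (fun s => (f s v : ℂ))
      (trig L (truncate N (collideCoef κ L (c t) (c t))) v) t := by
    intro t ht v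
    have h1 := hf.eqn t ⟨ht.1, ht.2.le⟩ v
    have h2 := (hc t ⟨ht.1.le, ht.2.le⟩).1
    rw [hκ _ (h2.isTame hL), (h2.collide h2).fourierProj_eq hL] at h1
    exact h1.hasDerivAt (Icc_mem_nhds ht.1 ht.2)
  refine ⟨c, fun t ht => (hc t ht).1, fun t ht => (hc t ht).2, fun k => ?_, fun t ht k => ?_,
    fun t ht => ⟨fun v => (trig L (truncate N (collideCoef κ L (c t) (c t))) v).re, fun v => ?_⟩⟩
  · obtain ⟨w, hw⟩ := exists_eval_combination hL N k
    have h : ContinuousOn (fun t => ∑ v ∈ w.support, w v * (f t v : ℂ)) (Icc 0 t₀) :=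
      continuousOn_finsetSum _ fun v _ =>
        continuousOn_const.mul (Complex.continuous_ofReal.comp_continuousOn (hf.cont v))
    refine h.congr fun t ht => ?_
    rw [hw _ (hc t ht).2]
    simp only [(hc t ht).1 _]
  · obtain ⟨w, hw⟩ := exists_eval_combination hL N k
    rw [hw _ (truncate_truncate N _)]
    have h : HasDerivAt (fun s => ∑ v ∈ w.support, w v * (f s v : ℂ)) (∑ v ∈ w.support,
        w v * trig L (truncate N (collideCoef κ L (c t) (c t))) v) t :=
      HasDerivAt.fun_sum fun v _ => (heqn t ht v).const_mul _
    refine h.congr_of_eventuallyEq ?_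
    filter_upwards [Icc_mem_nhds ht.1 ht.2] with s hs
    rw [hw _ (hc s hs).2]
    simp only [(hc s hs).1 _]
  -- The derivative of a real-valued function has vanishing imaginary part.
  · have h := heqn t ht v
    have him : HasDerivAt (fun s => ((f s v : ℂ)).im)
        (trig L (truncate N (collideCoef κ L (c t) (c t))) v).im t := by
      have h' := (Complex.imCLM.hasFDerivAt (x := (f t v : ℂ))).comp_hasDerivAt t h
      exact h'
    simp only [Complex.ofReal_im] at him
    have h0 := him.unique (hasDerivAt_const t (0 : ℝ))
    exact Complex.ext (by simp) (by simp [h0])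

lemma HasCoef.abs_le_sum {f : Vel d → ℝ} {c : Coef d} (h : HasCoef L f c)
    {S : Finset (Fin d → ℤ)} (hS : c.support ⊆ S) (v : Vel d) : |f v| ≤ ∑ k ∈ S, ‖c k‖ := by
  rw [← Real.norm_eq_abs, ← Complex.norm_real, h v, trig_apply]
  refine (norm_sum_le _ _).trans ?_
  simp only [norm_mul, norm_fourierMode, mul_one]
  exact Finset.sum_le_sum_of_subset_of_nonneg hS fun _ _ _ => norm_nonneg _

lemma HasCoef.const_mul {f : Vel d → ℝ} {c : Coef d} (h : HasCoef L f c) (r : ℝ) :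
    HasCoef L (fun v => r * f v) ((r : ℂ) • c) := fun v => by
  simp only [Complex.ofReal_mul, h v, trig, map_smul, Pi.smul_apply, smul_eq_mul]

/-- `φ'` is the derivative of `φ` up to a quadratic error of constant one, as is the case for the
square and for the square of the negative part. -/
structure IsQuadratic (L : ℝ) (d : ℕ) (φ φ' : ℝ → ℝ) : Prop where
  tame : ∀ g : Vel d → ℝ, IsTame L g → IsTame L fun v => φ (g v)
  tame' : ∀ g : Vel d → ℝ, IsTame L g → IsTame L fun v => φ' (g v)
  bound : ∀ x y, |φ y - φ x - φ' x * (y - x)| ≤ (y - x) ^ 2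

lemma isQuadratic_sq : IsQuadratic L d (fun x => x ^ 2) fun x => 2 * x := by
  refine ⟨fun g hg => by simpa only [sq] using hg.mul hg, fun g hg => (isTame_const 2).mul hg,
    fun x y => le_of_eq ?_⟩
  rw [← abs_of_nonneg (sq_nonneg (y - x))]
  congr 1
  ring

lemma isQuadratic_neg_sq :
    IsQuadratic L d (fun x => max (-x) 0 ^ 2) fun x => -2 * max (-x) 0 := by
  refine ⟨fun g hg => ?_, fun g hg => (isTame_const (-2)).mul hg.negativePart, fun x y => ?_⟩
  · have := hg.negativePart
    have h2 := this.mul this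
    simp only [sq]
    exact h2
  · rw [abs_le]
    rcases le_total x 0 with hx | hx <;> rcases le_total y 0 with hy | hy <;>
      simp only [hx, hy, max_eq_left, max_eq_right, neg_nonneg, neg_nonpos] <;>
      constructor <;> nlinarith

variable {φ φ' : ℝ → ℝ} {F : ℝ → Vel d → ℝ} {c : ℝ → Coef d} {I : Set ℝ}
  {S : Finset (Fin d → ℤ)} {t : ℝ}

lemma abs_integral_le_of_abs_le {g : Vel d → ℝ} {r : ℝ} (h : ∀ v, |g v| ≤ r) :
    |∫ v, g v ∂cellMeasure d L| ≤ r * (cellMeasure d L).real univ :=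
  norm_integral_le_of_norm_le_const (μ := cellMeasure d L) (f := g) (Eventually.of_forall h)

lemma IsQuadratic.continuousWithinAt (hφ : IsQuadratic L d φ φ') (hL : 0 < L)
    (hF : ∀ s ∈ I, HasCoef L (F s) (c s)) (hS : ∀ s ∈ I, (c s).support ⊆ S) (ht : t ∈ I)
    (hc : ∀ k, ContinuousWithinAt (fun s => c s k) I t) :
    ContinuousWithinAt (fun s => ∫ v, φ (F s v) ∂cellMeasure d L) I t := by
  set δ : ℝ → ℝ := fun s => ∑ k ∈ S, ‖c s k - c t k‖ with hδ
  have hδ0 : Tendsto δ (𝓝[I] t) (𝓝 0) := by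
    have h : ContinuousWithinAt δ I t := by
      have : ∀ k ∈ S, ContinuousWithinAt (fun s => ‖c s k - c t k‖) I t := fun k _ =>
        ((hc k).sub continuousWithinAt_const).norm
      exact tendsto_finsetSum _ this
    simpa [ContinuousWithinAt, hδ] using h
  obtain ⟨B, hB⟩ := (hφ.tame' _ ((hF t ht).isTame hL)).bdd
  rw [ContinuousWithinAt, tendsto_iff_norm_sub_tendsto_zero]
  refine squeeze_zero' (g := fun s => (δ s ^ 2 + B * δ s) * (cellMeasure d L).real univ)
    (Eventually.of_forall fun s => norm_nonneg _) ?_ ?_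
  · filter_upwards [self_mem_nhdsWithin] with s hs
    rw [← integral_sub (hφ.tame _ ((hF s hs).isTame hL)).integrable
      (hφ.tame _ ((hF t ht).isTame hL)).integrable, Real.norm_eq_abs]
    refine abs_integral_le_of_abs_le fun v => ?_
    have h1 := ((hF s hs).sub (hF t ht)).abs_le_sum
      (S := S) (fun k hk => by
        rcases Finset.mem_union.1 (Finsupp.support_sub hk) with h | h
        · exact hS s hs h
        · exact hS t ht h) v
    simp only [Finsupp.sub_apply] at h1
    have h2 := hφ.bound (F t v) (F s v)
    have h3 : (F s v - F t v) ^ 2 ≤ δ s ^ 2 := by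
      rw [← sq_abs]
      exact pow_le_pow_left₀ (abs_nonneg _) h1 2
    have h4 : |φ' (F t v) * (F s v - F t v)| ≤ B * δ s := by
      rw [abs_mul]
      exact mul_le_mul (hB v) h1 (abs_nonneg _) ((abs_nonneg _).trans (hB v))
    have h5 := abs_add_le (φ (F s v) - φ (F t v) - φ' (F t v) * (F s v - F t v))
      (φ' (F t v) * (F s v - F t v))
    rw [sub_add_cancel] at h5
    linarith
  · have := ((hδ0.pow 2).add (hδ0.const_mul B)).mul_const ((cellMeasure d L).real univ)
    simpa using this

/-- Differentiation of `∫ φ(F(t, v)) dv` along a differentiable curve of trigonometric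
polynomials. -/
lemma IsQuadratic.hasDerivAt (hφ : IsQuadratic L d φ φ') (hL : 0 < L) (hI : I ∈ 𝓝 t)
    (hF : ∀ s ∈ I, HasCoef L (F s) (c s)) (hS : ∀ s ∈ I, (c s).support ⊆ S)
    {G : Vel d → ℝ} {c' : Coef d} (hG : HasCoef L G c') (hS' : c'.support ⊆ S)
    (hc : ∀ k, HasDerivAt (fun s => c s k) (c' k) t) :
    HasDerivAt (fun s => ∫ v, φ (F s v) ∂cellMeasure d L)
      (∫ v, φ' (F t v) * G v ∂cellMeasure d L) t := by
  have ht : t ∈ I := mem_of_mem_nhds hI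
  -- `δ` and `ρ` bound, uniformly in `v`, the increment of `F` and its deviation from `(s - t) G`.
  set δ : ℝ → ℝ := fun s => ∑ k ∈ S, ‖c s k - c t k‖ with hδ
  set ρ : ℝ → ℝ := fun s => ∑ k ∈ S, ‖c s k - c t k - ((s - t : ℝ) : ℂ) * c' k‖ with hρ
  have hδO : δ =O[𝓝 t] fun s => s - t :=
    IsBigO.fun_sum fun k _ => (hc k).isBigO_sub.norm_left
  have hρo : ρ =o[𝓝 t] fun s => s - t := by
    refine IsLittleO.fun_sum fun k _ => IsLittleO.norm_left ?_
    have := hasDerivAt_iff_isLittleO.1 (hc k)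
    simpa only [Complex.real_smul] using this
  have hδo : (fun s => δ s ^ 2) =o[𝓝 t] fun s => s - t := by
    have h1 : (fun s => δ s ^ 2) =O[𝓝 t] fun s => (s - t) ^ 2 := hδO.pow 2
    refine h1.trans_isLittleO ?_
    have h2 : (fun s : ℝ => s - t) =o[𝓝 t] fun _ => (1 : ℝ) := by
      rw [isLittleO_one_iff]
      have : ContinuousAt (fun s : ℝ => s - t) t := by fun_prop
      simpa [ContinuousAt] using this
    simpa only [sq, one_mul] using h2.mul_isBigO (isBigO_refl (fun s : ℝ => s - t) (𝓝 t))
  have hFt := (hF t ht).isTame hL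
  obtain ⟨B, hB⟩ := (hφ.tame' _ hFt).bdd
  rw [hasDerivAt_iff_isLittleO]
  have hmaj : (fun s => (δ s ^ 2 + B * ρ s) * (cellMeasure d L).real univ) =o[𝓝 t]
      fun s => s - t := by
    have := (hδo.add (hρo.const_mul_left B)).const_mul_left ((cellMeasure d L).real univ)
    simpa only [mul_comm] using this
  refine IsBigO.trans_isLittleO (IsBigO.of_bound 1 ?_) hmaj
  filter_upwards [hI] with s hs
  have hFs := (hF s hs).isTame hL
  have hint : (∫ v, φ (F s v) ∂cellMeasure d L) - (∫ v, φ (F t v) ∂cellMeasure d L) -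
      (s - t) • (∫ v, φ' (F t v) * G v ∂cellMeasure d L) =
      ∫ v, (φ (F s v) - φ (F t v) - (s - t) * (φ' (F t v) * G v)) ∂cellMeasure d L := by
    have hi1 := (hφ.tame _ hFs).integrable
    have hi2 := (hφ.tame _ hFt).integrable
    have hi3 := ((hφ.tame' _ hFt).mul (hG.isTame hL)).integrable
    rw [integral_sub (f := fun v => φ (F s v) - φ (F t v)) (hi1.sub hi2) (hi3.const_mul _),
      integral_sub hi1 hi2, integral_const_mul, smul_eq_mul]
  rw [hint, one_mul, Real.norm_eq_abs]
  refine le_trans (abs_integral_le_of_abs_le fun v => ?_) (le_abs_self _)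
  have hsub : (c s - c t).support ⊆ S := fun k hk => by
    rcases Finset.mem_union.1 (Finsupp.support_sub hk) with h | h
    · exact hS s hs h
    · exact hS t ht h
  have h1 := ((hF s hs).sub (hF t ht)).abs_le_sum hsub v
  have h1' := (((hF s hs).sub (hF t ht)).sub (hG.const_mul (s - t))).abs_le_sum (S := S)
    (fun k hk => by
      rcases Finset.mem_union.1 (Finsupp.support_sub hk) with h | h
      · exact hsub h
      · exact hS' (Finsupp.support_smul h)) v
  simp only [Finsupp.sub_apply, Finsupp.smul_apply, smul_eq_mul] at h1 h1'
  have h2 := hφ.bound (F t v) (F s v)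
  have h3 : (F s v - F t v) ^ 2 ≤ δ s ^ 2 := by
    rw [← sq_abs]
    exact pow_le_pow_left₀ (abs_nonneg _) h1 2
  have h4 : |φ' (F t v) * (F s v - F t v - (s - t) * G v)| ≤ B * ρ s := by
    rw [abs_mul]
    exact mul_le_mul (hB v) h1' (abs_nonneg _) ((abs_nonneg _).trans (hB v))
  have h5 := abs_add_le (φ (F s v) - φ (F t v) - φ' (F t v) * (F s v - F t v))
    (φ' (F t v) * (F s v - F t v - (s - t) * G v))
  have h6 : φ (F s v) - φ (F t v) - φ' (F t v) * (F s v - F t v) +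
      φ' (F t v) * (F s v - F t v - (s - t) * G v) =
      φ (F s v) - φ (F t v) - (s - t) * (φ' (F t v) * G v) := by ring
  rw [h6] at h5
  linarith

end Flow

/-- Grönwall's inequality for a function that is differentiable at interior points only. -/
lemma le_exp_mul_of_deriv_le {y y' : ℝ → ℝ} {t₀ a b : ℝ} (ha : 0 < a)
    (hc : ContinuousOn y (Icc 0 t₀)) (hd : ∀ t ∈ Ioo 0 t₀, HasDerivAt y (y' t) t)
    (hy : ∀ t ∈ Ioo 0 t₀, y' t ≤ a * y t + b) {t : ℝ} (ht : t ∈ Icc 0 t₀) :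
    y t ≤ Real.exp (a * t) * (y 0 + b / a) - b / a := by
  -- The function `e^{-a t} (y + b / a)` is nonincreasing.
  set z : ℝ → ℝ := fun t => Real.exp (-(a * t)) * (y t + b / a) with hz
  have hzd : ∀ t ∈ Ioo 0 t₀, HasDerivAt z
      (Real.exp (-(a * t)) * (-(a * 1)) * (y t + b / a) + Real.exp (-(a * t)) * y' t) t := by
    intro t ht
    exact (((hasDerivAt_id t).const_mul a).fun_neg.exp).mul ((hd t ht).add_const _)
  have hanti : AntitoneOn z (Icc 0 t₀) := by
    refine antitoneOn_of_deriv_nonpos (convex_Icc _ _) ?_ ?_ ?_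
    · exact (Continuous.continuousOn (by fun_prop)).mul (hc.add continuousOn_const)
    · rw [interior_Icc]
      exact fun t ht => (hzd t ht).differentiableAt.differentiableWithinAt
    · rw [interior_Icc]
      intro t ht
      rw [(hzd t ht).deriv]
      have h1 := hy t ht
      have h2 : Real.exp (-(a * t)) * (-(a * 1)) * (y t + b / a) + Real.exp (-(a * t)) * y' t =
          Real.exp (-(a * t)) * (y' t - (a * y t + b)) := by
        field_simp
        ring
      rw [h2]
      exact mul_nonpos_of_nonneg_of_nonpos (Real.exp_pos _).le (by linarith)
  have h := hanti ⟨le_rfl, ht.1.trans ht.2⟩ ht ht.1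
  simp only [hz, mul_zero, neg_zero, Real.exp_zero, one_mul] at h
  have h3 := mul_le_mul_of_nonneg_left h (Real.exp_pos (a * t)).le
  rw [← mul_assoc, ← Real.exp_add, add_neg_cancel, Real.exp_zero, one_mul] at h3
  linarith

/-! ### A priori estimates -/

section Estimates

variable {d : ℕ} {L R : ℝ} {N : ℕ} {κ : Measure (Vel d × sphere (0 : Vel d) 1)} {C : ℝ≥0}
  {t₀ M K : ℝ}
  {f : ℝ → Vel d → ℝ} {c : ℝ → Coef d} {φ φ' : ℝ → ℝ} {t : ℝ}

lemma support_subset_of_truncate {c : Coef d} (h : truncate N c = c) :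
    c.support ⊆ modes d N := fun k hk => by
  by_contra hn
  rw [Finsupp.mem_support_iff, ← h, truncate_apply, if_neg hn] at hk
  exact hk rfl

lemma support_diffCoef_subset (i : Fin d) (c : Coef d) :
    (diffCoef L i c).support ⊆ c.support := fun k hk => by
  rw [Finsupp.mem_support_iff] at hk ⊢
  exact right_ne_zero_of_mul hk

/-- Continuity of the integral functionals along the flow, up to the end points. -/
lemma IsCoefFlow.continuousOn (h : IsCoefFlow κ L N t₀ f c) (hL : 0 < L)
    (hφ : IsQuadratic L d φ φ') :
    ContinuousOn (fun s => ∫ v, φ (f s v) ∂cellMeasure d L) (Icc 0 t₀) := fun _ ht =>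
  hφ.continuousWithinAt hL h.hasCoef (fun s hs => support_subset_of_truncate (h.trunc s hs)) ht
    fun k => h.cont k _ ht

lemma IsCoefFlow.continuousOn_partialDeriv (h : IsCoefFlow κ L N t₀ f c) (hL : 0 < L)
    (hφ : IsQuadratic L d φ φ') (i : Fin d) :
    ContinuousOn (fun s => ∫ v, φ (partialDeriv i (f s) v) ∂cellMeasure d L) (Icc 0 t₀) :=
  fun _ ht => hφ.continuousWithinAt hL (fun s hs => (h.hasCoef s hs).partialDeriv i)
    (fun s hs => (support_diffCoef_subset i _).trans (support_subset_of_truncate (h.trunc s hs))) ht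
    fun k => continuousWithinAt_const.mul (h.cont k _ ht)

lemma IsCoefFlow.hasDerivAt (h : IsCoefFlow κ L N t₀ f c) (hL : 0 < L)
    (hφ : IsQuadratic L d φ φ') (ht : t ∈ Ioo 0 t₀) {g : Vel d → ℝ}
    (hg : HasCoef L g (truncate N (collideCoef κ L (c t) (c t)))) :
    HasDerivAt (fun s => ∫ v, φ (f s v) ∂cellMeasure d L)
      (∫ v, φ' (f t v) * g v ∂cellMeasure d L) t :=
  hφ.hasDerivAt hL (Icc_mem_nhds ht.1 ht.2) h.hasCoef
    (fun s hs => support_subset_of_truncate (h.trunc s hs)) hg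
    (support_subset_of_truncate (truncate_truncate N _)) (h.deriv t ht)

lemma IsCoefFlow.hasDerivAt_partialDeriv (h : IsCoefFlow κ L N t₀ f c) (hL : 0 < L)
    (hφ : IsQuadratic L d φ φ') (i : Fin d) (ht : t ∈ Ioo 0 t₀) {g : Vel d → ℝ}
    (hg : HasCoef L g (truncate N (collideCoef κ L (c t) (c t)))) :
    HasDerivAt (fun s => ∫ v, φ (partialDeriv i (f s) v) ∂cellMeasure d L)
      (∫ v, φ' (partialDeriv i (f t) v) * partialDeriv i g v ∂cellMeasure d L) t :=
  hφ.hasDerivAt hL (Icc_mem_nhds ht.1 ht.2) (fun s hs => (h.hasCoef s hs).partialDeriv i)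
    (fun s hs => (support_diffCoef_subset i _).trans (support_subset_of_truncate (h.trunc s hs)))
    (hg.partialDeriv i)
    ((support_diffCoef_subset i _).trans (support_subset_of_truncate (truncate_truncate N _)))
    fun k => (h.deriv t ht k).const_mul _

/-- A differential inequality `(‖F‖²)' ≤ 2 a ‖F‖²`, in integral form. -/
lemma normL2_le_of_deriv {F : ℝ → Vel d → ℝ} {G : ℝ → Vel d → ℝ} {a : ℝ} (ha : 0 < a)
    (hF : ∀ s ∈ Icc 0 t₀, IsTame L (F s)) (hG : ∀ s ∈ Ioo 0 t₀, IsTame L (G s))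
    (hc : ContinuousOn (fun s => ∫ v, F s v ^ 2 ∂cellMeasure d L) (Icc 0 t₀))
    (hd : ∀ s ∈ Ioo 0 t₀, HasDerivAt (fun s => ∫ v, F s v ^ 2 ∂cellMeasure d L)
      (∫ v, 2 * F s v * G s v ∂cellMeasure d L) s)
    (hFG : ∀ s ∈ Ioo 0 t₀, normL2 L (G s) ≤ a * normL2 L (F s)) (ht : t ∈ Icc 0 t₀) :
    normL2 L (F t) ≤ Real.exp (t * a) * normL2 L (F 0) := by
  have h := le_exp_mul_of_deriv_le (a := 2 * a) (b := 0) (by linarith) hc hd (fun s hs => ?_) ht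
  · rw [zero_div, add_zero, sub_zero, ← normL2_sq (hF t ht),
      ← normL2_sq (hF 0 ⟨le_rfl, ht.1.trans ht.2⟩)] at h
    refine (sq_le_sq₀ normL2_nonneg (mul_nonneg (Real.exp_pos _).le normL2_nonneg)).1 ?_
    rw [mul_pow, ← Real.exp_nat_mul]
    refine h.trans_eq ?_
    congr 2
    push_cast
    ring
  · have hs' : s ∈ Icc 0 t₀ := ⟨hs.1.le, hs.2.le⟩
    have h1 := (le_abs_self _).trans (abs_integral_mul_le (hF s hs') (hG s hs))
    have h2 := mul_le_mul_of_nonneg_left (hFG s hs) (normL2_nonneg (L := L) (f := F s))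
    have h3 := normL2_sq (hF s hs')
    simp only [mul_assoc, integral_const_mul]
    rw [← h3]
    nlinarith

/-- The gradient of the collision operator, by Leibniz' rule and the bilinear estimate. -/
lemma BoundedLaws.normL2_partialDeriv_collide_le (hκ : BoundedLaws κ R C) (hL : 0 < L)
    (hRL : R ≤ L) {g : Vel d → ℝ} {a : Coef d} (hg : HasCoef L g a) (i : Fin d) :
    normL2 L (partialDeriv i (collide κ g g)) ≤
      2 * C * (normL1 L g + Real.sqrt ((2 * L) ^ d) * normL2 L g) *
        normL2 L (partialDeriv i g) := by
  have := hκ.isFiniteMeasure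
  have hgt := hg.isTame hL
  have hdt := (hg.partialDeriv i).isTame hL
  have h1 := hκ.normL2_collide_le hL hRL hdt hgt
  have h2 := hκ.normL2_collide_le hL hRL hgt hdt
  have h3 := normL1_le hL hdt
  have heq : partialDeriv i (collide κ g g) =
      fun v => collide κ (partialDeriv i g) g v + collide κ g (partialDeriv i g) v := by
    funext v
    have e1 := (hg.collide hg (κ := κ)).partialDeriv i v
    have e2 := (((hg.partialDeriv i).collide hg (κ := κ)).add
      (hg.collide (κ := κ) (hg.partialDeriv i))) v
    rw [diffCoef_collideCoef, ← e2] at e1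
    exact_mod_cast e1
  have h4 := normL2_add_le (isTame_collide (κ := κ) hdt hgt) (collide κ g (partialDeriv i g))
  rw [heq]
  have h5 : 2 * C * normL1 L (partialDeriv i g) * normL2 L g ≤
      2 * C * (Real.sqrt ((2 * L) ^ d) * normL2 L (partialDeriv i g)) * normL2 L g := by
    have := normL2_nonneg (L := L) (f := g)
    gcongr
  linarith

lemma normH1_sq (f : Vel d → ℝ) :
    normH1 L f ^ 2 = normL2 L f ^ 2 + ∑ i, normL2 L (partialDeriv i f) ^ 2 := by
  rw [normH1, Real.sq_sqrt]
  exact add_nonneg (sq_nonneg _) (Finset.sum_nonneg fun _ _ => sq_nonneg _)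

lemma normH1_nonneg (f : Vel d → ℝ) : 0 ≤ normH1 L f := Real.sqrt_nonneg _

lemma normL2_le_normH1 (f : Vel d → ℝ) : normL2 L f ≤ normH1 L f :=
  Real.le_sqrt_of_sq_le (le_add_of_nonneg_right (Finset.sum_nonneg fun _ _ => sq_nonneg _))

/-- The truncation error of the collision operator is of order `1 / N`. -/
lemma BoundedLaws.normL2_collide_sub_le (hκ : BoundedLaws κ R C) (hL : 0 < L) (hRL : R ≤ L)
    (hN : 1 ≤ N) {g h : Vel d → ℝ} {a : Coef d} (hg : HasCoef L g a)
    (hh : HasCoef L h (truncate N (collideCoef κ L a a))) :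
    normL2 L (fun v => collide κ g g v - h v) ≤
      8 * L * C * Real.sqrt ((2 * L) ^ d) / Real.pi * normH1 L g ^ 2 / N := by
  have := hκ.isFiniteMeasure
  have hQ := hg.collide hg (κ := κ)
  set S := Real.sqrt ((2 * L) ^ d) with hS
  have hS0 : 0 ≤ S := Real.sqrt_nonneg _
  have hNpos : (0 : ℝ) < N := by exact_mod_cast hN
  have hH0 := normH1_nonneg (L := L) g
  have hpi := Real.pi_pos
  have hgrad : ∀ i, normL2 L (partialDeriv i (collide κ g g)) ^ 2 ≤
      (4 * C * S * normH1 L g) ^ 2 * normL2 L (partialDeriv i g) ^ 2 := by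
    intro i
    rw [← mul_pow]
    refine pow_le_pow_left₀ normL2_nonneg ?_ 2
    refine (hκ.normL2_partialDeriv_collide_le hL hRL hg i).trans ?_
    refine mul_le_mul_of_nonneg_right ?_ normL2_nonneg
    have h1 := normL1_le hL (hg.isTame hL)
    have h2 := mul_le_mul_of_nonneg_left (normL2_le_normH1 (L := L) g) hS0
    have h3 : normL1 L g + S * normL2 L g ≤ 2 * (S * normH1 L g) := by linarith
    have h4 := mul_le_mul_of_nonneg_left h3 (by positivity : (0 : ℝ) ≤ 2 * C)
    linarith
  have hsum : ∑ i, normL2 L (partialDeriv i (collide κ g g)) ^ 2 ≤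
      (4 * C * S * normH1 L g ^ 2) ^ 2 := by
    refine (Finset.sum_le_sum fun i _ => hgrad i).trans ?_
    rw [← Finset.mul_sum]
    have h1 : ∑ i, normL2 L (partialDeriv i g) ^ 2 ≤ normH1 L g ^ 2 := by
      rw [normH1_sq]
      exact le_add_of_nonneg_left (sq_nonneg _)
    calc _ ≤ (4 * C * S * normH1 L g) ^ 2 * normH1 L g ^ 2 := by gcongr
      _ = _ := by ring
  refine (sq_le_sq₀ normL2_nonneg (by positivity)).1 ?_
  rw [(hQ.sub hh).normL2_sq hL]
  calc (2 * L) ^ d * energy (collideCoef κ L a a - truncate N (collideCoef κ L a a))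
      ≤ (2 * L) ^ d * ((2 * L / (Real.pi * N)) ^ 2 *
          ∑ i, energy (diffCoef L i (collideCoef κ L a a))) := by
        gcongr
        exact energy_sub_truncate_le hL hN _
    _ = (2 * L / (Real.pi * N)) ^ 2 * ∑ i, normL2 L (partialDeriv i (collide κ g g)) ^ 2 := by
        simp only [(hQ.partialDeriv _).normL2_sq hL, ← Finset.mul_sum]
        ring
    _ ≤ (2 * L / (Real.pi * N)) ^ 2 * (4 * C * S * normH1 L g ^ 2) ^ 2 := by gcongr
    _ = _ := by
        rw [← mul_pow]
        congr 1
        field_simp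
        ring

lemma IsCoefFlow.exists_rhs (h : IsCoefFlow κ L N t₀ f c) : ∃ g : ℝ → Vel d → ℝ,
    ∀ s ∈ Ioo 0 t₀, HasCoef L (g s) (truncate N (collideCoef κ L (c s) (c s))) := by
  classical
  choose g hg using h.real
  exact ⟨fun s => if hs : s ∈ Ioo 0 t₀ then g s hs else 0, fun s hs => by
    simpa only [dif_pos hs] using hg s hs⟩

/-- Propagation of the `L²` norm. -/
theorem IsCoefFlow.normL2_le (h : IsCoefFlow κ L N t₀ f c) (hκ : BoundedLaws κ R C) (hL : 0 < L)
    (hRL : R ≤ L) (hM : 0 < M) (hf : ∀ s ∈ Icc 0 t₀, normL1 L (f s) ≤ M) (ht : t ∈ Icc 0 t₀) :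
    normL2 L (f t) ≤ Real.exp (t * ((2 * C + 1) * M)) * normL2 L (f 0) := by
  have := hκ.isFiniteMeasure
  obtain ⟨g, hg⟩ := h.exists_rhs
  refine normL2_le_of_deriv (by positivity) (fun s hs => (h.hasCoef s hs).isTame hL)
    (fun s hs => (hg s hs).isTame hL) (h.continuousOn hL isQuadratic_sq)
    (fun s hs => h.hasDerivAt hL isQuadratic_sq hs (hg s hs)) (fun s hs => ?_) ht
  have hs' : s ∈ Icc 0 t₀ := ⟨hs.1.le, hs.2.le⟩
  have hfs := h.hasCoef s hs'
  refine ((hg s hs).normL2_le hL (hfs.collide hfs) (energy_mono (norm_truncate_le N _))).trans ?_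
  refine (hκ.normL2_collide_le hL hRL (hfs.isTame hL) (hfs.isTame hL)).trans ?_
  refine mul_le_mul_of_nonneg_right ?_ normL2_nonneg
  exact mul_le_mul (by linarith) (hf s hs') normL1_nonneg (by positivity)

/-- Propagation of the derivatives, linear in them because the `L²` norm is already controlled. -/
theorem IsCoefFlow.normL2_partialDeriv_le (h : IsCoefFlow κ L N t₀ f c) (hκ : BoundedLaws κ R C)
    (hL : 0 < L) (hRL : R ≤ L) (hM : 0 < M) (hf : ∀ s ∈ Icc 0 t₀, normL1 L (f s) ≤ M)
    (hK : ∀ s ∈ Icc 0 t₀, normL2 L (f s) ≤ K) (i : Fin d) (ht : t ∈ Icc 0 t₀) :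
    normL2 L (partialDeriv i (f t)) ≤
      Real.exp (t * ((2 * C * (1 + Real.sqrt ((2 * L) ^ d)) + 1) * (M + K))) *
        normL2 L (partialDeriv i (f 0)) := by
  have := hκ.isFiniteMeasure
  have hK0 : 0 ≤ K := normL2_nonneg.trans (hK t ht)
  have hS0 : 0 ≤ Real.sqrt ((2 * L) ^ d) := Real.sqrt_nonneg _
  obtain ⟨g, hg⟩ := h.exists_rhs
  refine normL2_le_of_deriv (F := fun s => partialDeriv i (f s))
    (G := fun s => partialDeriv i (g s)) (by positivity)
    (fun s hs => ((h.hasCoef s hs).partialDeriv i).isTame hL)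
    (fun s hs => ((hg s hs).partialDeriv i).isTame hL)
    (h.continuousOn_partialDeriv hL isQuadratic_sq i)
    (fun s hs => h.hasDerivAt_partialDeriv hL isQuadratic_sq i hs (hg s hs)) (fun s hs => ?_) ht
  have hs' : s ∈ Icc 0 t₀ := ⟨hs.1.le, hs.2.le⟩
  have hfs := h.hasCoef s hs'
  refine (((hg s hs).partialDeriv i).normL2_le hL ((hfs.collide hfs (κ := κ)).partialDeriv i)
    (by rw [diffCoef_truncate]; exact energy_mono (norm_truncate_le N _))).trans ?_
  refine (hκ.normL2_partialDeriv_collide_le hL hRL hfs i).trans ?_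
  refine mul_le_mul_of_nonneg_right ?_ normL2_nonneg
  set S := Real.sqrt ((2 * L) ^ d)
  have h1 : normL1 L (f s) + S * normL2 L (f s) ≤ M + S * K :=
    add_le_add (hf s hs') (mul_le_mul_of_nonneg_left (hK s hs') hS0)
  calc 2 * C * (normL1 L (f s) + S * normL2 L (f s)) ≤ 2 * C * (M + S * K) := by gcongr
    _ ≤ 2 * C * ((1 + S) * (M + K)) := by
        gcongr
        nlinarith [mul_nonneg hS0 hM.le]
    _ ≤ (2 * C * (1 + S) + 1) * (M + K) := by nlinarith

/-- Growth of the negative part: it is amplified at a linear rate and fed by the truncation error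
`ε` only. The product `ε ‖f⁻‖` is absorbed by Young's inequality. -/
theorem IsCoefFlow.normL2_negativePart_le (h : IsCoefFlow κ L N t₀ f c) (hκ : BoundedLaws κ R C)
    (hL : 0 < L) (hRL : R ≤ L) (hN : 1 ≤ N) (hM : 0 < M)
    (hf : ∀ s ∈ Icc 0 t₀, normL1 L (f s) ≤ M) (hK : ∀ s ∈ Icc 0 t₀, normL2 L (f s) ≤ K)
    {H : ℝ} (hH : ∀ s ∈ Icc 0 t₀, normH1 L (f s) ≤ H) (ht : t ∈ Icc 0 t₀) :
    normL2 L (negativePart (f t)) ≤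
      Real.exp (t * ((C * (2 + Real.sqrt ((2 * L) ^ d)) + 1) * (M + K))) *
        (normL2 L (negativePart (f 0)) +
          8 * L * C * Real.sqrt ((2 * L) ^ d) / Real.pi * H ^ 2 / (M * N)) := by
  have := hκ.isFiniteMeasure
  have hK0 : 0 ≤ K := normL2_nonneg.trans (hK t ht)
  have hH0 : 0 ≤ H := (normH1_nonneg _).trans (hH t ht)
  have hNpos : (0 : ℝ) < N := by exact_mod_cast hN
  have hpi := Real.pi_pos
  set S := Real.sqrt ((2 * L) ^ d) with hS
  have hS0 : 0 ≤ S := Real.sqrt_nonneg _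
  set A := (C * (2 + S) + 1) * (M + K) with hA
  have hApos : 0 < A := by positivity
  have hAM : M ≤ A := by
    have : 0 ≤ C * (2 + S) * (M + K) := by positivity
    rw [hA]
    linarith
  set ε := 8 * L * C * S / Real.pi * H ^ 2 / N with hε
  have hε0 : 0 ≤ ε := by positivity
  obtain ⟨g, hg⟩ := h.exists_rhs
  have hgron := le_exp_mul_of_deriv_le (a := 2 * A) (b := ε ^ 2 / (2 * (M + K))) (t := t)
    (by linarith)
    (h.continuousOn hL isQuadratic_neg_sq)
    (fun s hs => h.hasDerivAt hL isQuadratic_neg_sq hs (hg s hs)) (fun s hs => ?_) ht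
  · have hft := ((h.hasCoef t ht).isTame hL).negativePart
    have hf0 := ((h.hasCoef 0 ⟨le_rfl, ht.1.trans ht.2⟩).isTame hL).negativePart
    have e1 : ∫ v, max (-f t v) 0 ^ 2 ∂cellMeasure d L = normL2 L (negativePart (f t)) ^ 2 :=
      (normL2_sq hft).symm
    have e2 : ∫ v, max (-f 0 v) 0 ^ 2 ∂cellMeasure d L = normL2 L (negativePart (f 0)) ^ 2 :=
      (normL2_sq hf0).symm
    rw [e1, e2] at hgron
    have hn0 := normL2_nonneg (L := L) (f := negativePart (f 0))
    refine (sq_le_sq₀ normL2_nonneg (by positivity)).1 ?_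
    have hexp : Real.exp (t * A) ^ 2 = Real.exp (2 * A * t) := by
      rw [← Real.exp_nat_mul]
      congr 1
      push_cast
      ring
    rw [mul_pow, hexp]
    have h1 : 0 ≤ ε ^ 2 / (2 * (M + K)) / (2 * A) := by positivity
    refine (hgron.trans (sub_le_self _ h1)).trans ?_
    refine mul_le_mul_of_nonneg_left ?_ (Real.exp_pos _).le
    have h2 : ε ^ 2 / (2 * (M + K)) / (2 * A) ≤ (ε / M) ^ 2 := by
      have hden : M ^ 2 ≤ 2 * (M + K) * (2 * A) := by nlinarith [mul_nonneg hK0 hApos.le]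
      calc ε ^ 2 / (2 * (M + K)) / (2 * A) = ε ^ 2 / (2 * (M + K) * (2 * A)) := div_div _ _ _
        _ ≤ ε ^ 2 / M ^ 2 :=
          div_le_div_of_nonneg_left (sq_nonneg ε) (by positivity) hden
        _ = (ε / M) ^ 2 := (div_pow ε M 2).symm
    have h3 : 8 * L * C * S / Real.pi * H ^ 2 / (M * N) = ε / M := by
      rw [hε]
      field_simp
    rw [h3]
    have h4 : 0 ≤ ε / M := by positivity
    nlinarith
  · have hs' : s ∈ Icc 0 t₀ := ⟨hs.1.le, hs.2.le⟩
    have hfs := h.hasCoef s hs'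
    have hft := hfs.isTame hL
    have hn := hft.negativePart
    have hQ := isTame_collide (κ := κ) hft hft
    have hgt := (hg s hs).isTame hL
    set n := normL2 L (negativePart (f s)) with hn_def
    have hn0 : 0 ≤ n := normL2_nonneg
    have e1 : ∫ v, max (-f s v) 0 ^ 2 ∂cellMeasure d L = n ^ 2 := (normL2_sq hn).symm
    have e2 : ∫ v, -2 * max (-f s v) 0 * g s v ∂cellMeasure d L =
        2 * (-∫ v, negativePart (f s) v * collide κ (f s) (f s) v ∂cellMeasure d L) +
          2 * ∫ v, negativePart (f s) v * (collide κ (f s) (f s) v - g s v) ∂cellMeasure d L := by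
      rw [← integral_neg, ← integral_const_mul, ← integral_const_mul,
        ← integral_add ((hn.mul hQ).neg.integrable.const_mul _)
          ((hn.mul (hQ.sub hgt)).integrable.const_mul _)]
      refine integral_congr_ae (Eventually.of_forall fun v => ?_)
      simp only [negativePart]
      ring
    simp only [e1, e2]
    have h1 := hκ.neg_integral_negativePart_mul_collide_le hL hRL hft
    have h2 := (le_abs_self _).trans (abs_integral_mul_le hn (hQ.sub hgt))
    have h3 := hκ.normL2_collide_sub_le hL hRL hN hfs (hg s hs)
    have h4 : 8 * L * C * S / Real.pi * normH1 L (f s) ^ 2 / N ≤ ε := by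
      have := normH1_nonneg (L := L) (f s)
      have := hH s hs'
      rw [hε]
      gcongr
    have h5 : C * (2 * normL1 L (f s) + S * normL2 L (f s)) * n ^ 2 ≤
        C * (2 + S) * (M + K) * n ^ 2 := by
      have h51 := hf s hs'
      have h52 := mul_le_mul_of_nonneg_left (hK s hs') hS0
      have h53 : 2 * normL1 L (f s) + S * normL2 L (f s) ≤ (2 + S) * (M + K) := by
        nlinarith [mul_nonneg hS0 hM.le]
      rw [mul_assoc (C : ℝ) (2 + S)]
      gcongr
    have h6 := mul_le_mul_of_nonneg_left (h3.trans h4) hn0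
    have hMK : 0 < M + K := by linarith
    -- Young's inequality; the summand `1` in the rate `A` pays for `2 (M + K) n ^ 2`.
    have h7 : 2 * (n * ε) ≤ 2 * (M + K) * n ^ 2 + ε ^ 2 / (2 * (M + K)) := by
      have h8 : 2 * (M + K) * n ^ 2 + ε ^ 2 / (2 * (M + K)) - 2 * (n * ε) =
          (2 * (M + K) * n - ε) ^ 2 / (2 * (M + K)) := by
        field_simp
        ring
      have h9 : 0 ≤ (2 * (M + K) * n - ε) ^ 2 / (2 * (M + K)) := by positivity
      linarith
    have h10 : 2 * A * n ^ 2 = 2 * (C * (2 + S) * (M + K) * n ^ 2) + 2 * (M + K) * n ^ 2 := by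
      rw [hA]
      ring
    linarith

end Estimates

end

end FourierBoltzmann

theorem mainTheorem3 (d : ℕ) (hd : 2 ≤ d) (R L : ℝ) (hR : 0 < R) (hRL : R ≤ L)
    (Φ b : ℝ → ℝ) (hΦm : Measurable Φ) (hΦ : ∀ r, 0 ≤ r → 0 ≤ Φ r)
    (hΦb : eLpNorm ((closedBall (0 : FourierBoltzmann.Vel d) R).indicator fun v => Φ ‖v‖) ⊤
      (FourierBoltzmann.cellMeasure d L) < ⊤)
    (hbm : Measurable b) (hb : ∀ c ∈ Icc (-1 : ℝ) 1, 0 ≤ b c)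
    (hcut : ∀ e : FourierBoltzmann.Vel d, ‖e‖ = 1 →
      Integrable (fun σ : sphere (0 : FourierBoltzmann.Vel d) 1 =>
        FourierBoltzmann.symmetrized b ⟪(σ : FourierBoltzmann.Vel d), e⟫)
        (FourierBoltzmann.sphereMeasure d)) :
    ∃ D₀ D₁ D₂ D₃ D₄ : ℝ, 0 < D₀ ∧ 0 < D₁ ∧ 0 < D₂ ∧ 0 < D₃ ∧ 0 < D₄ ∧
      ∀ (N : ℕ) (t₀ M : ℝ) (f₀ : FourierBoltzmann.Vel d → ℝ)
        (f : ℝ → FourierBoltzmann.Vel d → ℝ), 1 ≤ N → 0 ≤ t₀ → 0 < M →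
        FourierBoltzmann.IsGalerkinSolution Φ (FourierBoltzmann.symmetrized b) R L N t₀ f₀ f →
        (∀ t ∈ Icc 0 t₀, FourierBoltzmann.normL1 L (f t) ≤ M) →
        ∀ t ∈ Icc 0 t₀,
          FourierBoltzmann.normL2 L (f t) ≤ FourierBoltzmann.boundK0 L D₀ t₀ M f₀ ∧
          FourierBoltzmann.normH1 L (f t) ≤ FourierBoltzmann.boundK1 L D₀ D₁ D₂ t₀ M f₀ ∧
          FourierBoltzmann.normL2 L (FourierBoltzmann.negativePart (f t)) ≤
            Real.exp (t₀ * D₃ * (M + FourierBoltzmann.boundK0 L D₀ t₀ M f₀)) *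
              (FourierBoltzmann.normL2 L (FourierBoltzmann.negativePart f₀) +
                D₄ * FourierBoltzmann.boundK1 L D₀ D₁ D₂ t₀ M f₀ ^ 2 / (M * N)) := by
  open FourierBoltzmann in
  obtain ⟨C, hκ⟩ := exists_boundedLaws hd hRL hΦm hΦ hΦb hbm hcut
  have hfin := hκ.isFiniteMeasure
  have hL : 0 < L := hR.trans_le hRL
  have hpi := Real.pi_pos
  set S := Real.sqrt ((2 * L) ^ d) with hS
  have hS0 : 0 ≤ S := Real.sqrt_nonneg _
  -- The summands `1` keep the constants positive even when `C = 0`; `D₂` may be any positive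
  -- number.
  refine ⟨2 * C + 1, 2 * C * (1 + S) + 1, 1, C * (2 + S) + 1, 8 * L * C * S / Real.pi + 1,
    by positivity, by positivity, one_pos, by positivity, by positivity, ?_⟩
  intro N t₀ M f₀ f hN ht₀ hM hsol hfM
  obtain ⟨c, hc⟩ := exists_isCoefFlow hL hsol fun g hg => funext fun v =>
    collision_eq_integral hΦm hΦ hbm hb hg.cont hg.cont hg.bdd hg.bdd v
  have hinit := hsol.init
  set K := boundK0 L (2 * C + 1) t₀ M f₀ with hKdef
  set H := boundK1 L (2 * C + 1) (2 * C * (1 + S) + 1) 1 t₀ M f₀ with hHdef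
  have hK : ∀ s ∈ Icc 0 t₀, normL2 L (f s) ≤ K := by
    intro s hs
    refine (hc.normL2_le hκ hL hRL hM hfM hs).trans ?_
    rw [hinit, hKdef, boundK0, mul_assoc t₀]
    refine mul_le_mul_of_nonneg_right (Real.exp_le_exp.2 ?_) normL2_nonneg
    exact mul_le_mul_of_nonneg_right hs.2 (by positivity)
  have hK0 : 0 ≤ K := normL2_nonneg.trans (hK 0 ⟨le_rfl, ht₀⟩)
  have hH : ∀ s ∈ Icc 0 t₀, normH1 L (f s) ≤ H := by
    intro s hs
    set E := Real.exp (t₀ * ((2 * C * (1 + S) + 1) * (M + K))) with hE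
    have hCS : 2 * C + 1 ≤ 2 * C * (1 + S) + 1 := by
      nlinarith [mul_nonneg C.coe_nonneg hS0]
    have h0 : normL2 L (f s) ≤ E * normL2 L f₀ := by
      refine (hc.normL2_le hκ hL hRL hM hfM hs).trans ?_
      rw [hinit]
      refine mul_le_mul_of_nonneg_right (Real.exp_le_exp.2 ?_) normL2_nonneg
      have := hs.1
      gcongr
      · exact hs.2
      · linarith
    have h1 : ∀ i, normL2 L (partialDeriv i (f s)) ≤ E * normL2 L (partialDeriv i f₀) := by
      intro i
      refine (hc.normL2_partialDeriv_le hκ hL hRL hM hfM hK i hs).trans ?_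
      rw [hinit]
      refine mul_le_mul_of_nonneg_right (Real.exp_le_exp.2 ?_) normL2_nonneg
      exact mul_le_mul_of_nonneg_right hs.2 (by positivity)
    have hE0 : 0 < E := Real.exp_pos _
    have h2 : normH1 L (f s) ≤ E * normH1 L f₀ := by
      refine (sq_le_sq₀ (normH1_nonneg _) (mul_nonneg hE0.le (normH1_nonneg _))).1 ?_
      rw [mul_pow, normH1_sq, normH1_sq, mul_add, Finset.mul_sum]
      simp only [← mul_pow]
      exact add_le_add (pow_le_pow_left₀ normL2_nonneg h0 2)
        (Finset.sum_le_sum fun i _ => pow_le_pow_left₀ normL2_nonneg (h1 i) 2)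
    refine h2.trans ?_
    rw [hHdef, boundK1, ← hKdef, mul_assoc t₀, ← hE]
    exact mul_le_mul_of_nonneg_left (by linarith) hE0.le
  intro t ht
  refine ⟨hK t ht, hH t ht, ?_⟩
  refine (hc.normL2_negativePart_le hκ hL hRL hN hM hfM hK hH ht).trans ?_
  have hNpos : (0 : ℝ) < N := by exact_mod_cast hN
  have hn0 := normL2_nonneg (L := L) (f := negativePart f₀)
  rw [hinit, mul_assoc t₀]
  gcongr
  · exact ht.2
  · linarith
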